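/- Consider the four contractions of $\mathbb{R}^2$ $$F_0(x,y)=\left(\tfrac29x+\tfrac{8}{9\sqrt3}y,\ \tfrac23y\right),\quad F_1(x,y)=\left(\tfrac29x-\tfrac{8}{9\sqrt3}y,\ \tfrac23y\right),$$ $$F_2(x,y)=\left(\tfrac13x-\tfrac23,\ \tfrac13y-\tfrac1{\sqrt3}\right),\quad F_3(x,y)=\left(\tfrac13x+\tfrac23,\ \tfrac13y-\tfrac1{\sqrt3}\right),$$ and let $K$ be their invariant set, i.e. the unique nonempty compact set with $K=\bigcup_{i=0}^3F_i(K)$. Let $q_1=(0,0)$, $q_2=(-1,-\frac{\sqrt3}2)$, $q_3=(1,-\frac{\sqrt3}2)$ be the fixed points of $F_0$ (and $F_1$), $F_2$ and $F_3$, and let $q_0=F_0(q_2)=F_2(q_1)$. For $u\in C(K)$ put $$E_0(u)=(u(q_1)-u(q_2))^2+(u(q_1)-u(q_3))^2,\qquad E_{n+1}(u)=\sum_{i=0}^3 2\,E_n(u\circ F_i),$$ and let $\mathcal{E}(u)=\lim_{n\to\infty}E_n(u)\in[0,\infty]$ (the sequence is nondecreasing), so that $\mathcal{E}$ is the self-similar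 Dirichlet form on $K$ with all resistance scaling factors equal to $\frac12$ and with domain $\{u\in C(K):\mathcal{E}(u)<\infty\}$. For disjoint Borel sets $A,B\subset K$ let $$R(A,B)=1/\inf\{\mathcal{E}(u):\ u\in C(K),\ u|_A=0,\ u|_B=1\}$$ be the effective resistance, write $R(x,A)=R(\{x\},A)$ and $R(x,y)=R(\{x\},\{y\})$ for $x\neq y$, and set $R(x,x)=0$. For $n\ge1$ let $B_n=\{x\in K:\ R(x,q_0)<2^{-n}\}$ and $B_n^c=K\setminus B_n$. Then there exists a constant $C\ge1$ such that for every $n\ge1$ and every $x\in B_n$, $$C^{-1}\,\min\left\{2^{-n}-R(x,q_0),\ R(x,q_0)+2^{-2n}\right\}\ \le\ R(x,B_n^c)\ \le\ C\,\min\left\{2^{-n}-R(x,q_0),\ R(x,q_0)+2^{-2n}\right\}.$$ -/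

import Mathlib

open scoped ENNReal Topology

noncomputable section

namespace TreeFractal

/-- The four contractions `F₀, F₁, F₂, F₃` of the plane. -/
def planeMap : Fin 4 → ℝ × ℝ → ℝ × ℝ
  | 0, p => (2 / 9 * p.1 + 8 / (9 * Real.sqrt 3) * p.2, 2 / 3 * p.2)
  | 1, p => (2 / 9 * p.1 - 8 / (9 * Real.sqrt 3) * p.2, 2 / 3 * p.2)
  | 2, p => (1 / 3 * p.1 - 2 / 3, 1 / 3 * p.2 - 1 / Real.sqrt 3)
  | 3, p => (1 / 3 * p.1 + 2 / 3, 1 / 3 * p.2 - 1 / Real.sqrt 3)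

/-- The three boundary points `q₁, q₂, q₃` (indexed by `0, 1, 2`): the fixed points of `F₀` (and
of `F₁`), of `F₂` and of `F₃`. -/
def corner : Fin 3 → ℝ × ℝ
  | 0 => (0, 0)
  | 1 => (-1, -(Real.sqrt 3 / 2))
  | 2 => (1, -(Real.sqrt 3 / 2))

/-- `V₀ = {q₁, q₂, q₃}` and `V_{n+1} = ⋃ i, F_i (V_n)`. -/
def vertexSet : ℕ → Set (ℝ × ℝ)
  | 0 => Set.range corner
  | n + 1 => ⋃ i, planeMap i '' vertexSet n

/-- The fractal `K`: the closure of `V_* = ⋃ n, V_n`. By `fractalSet_isCompact`,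
`fractalSet_invariant` and `fractalSet_unique` below it is the unique nonempty compact set with
`K = ⋃ i, F_i (K)`, that is, the invariant set of the iterated function system. -/
def fractalSet : Set (ℝ × ℝ) := closure (⋃ n, vertexSet n)

theorem sqrt_three_div : 1 / Real.sqrt 3 = Real.sqrt 3 / 3 := by
  have h : Real.sqrt 3 * Real.sqrt 3 = 3 := Real.mul_self_sqrt (by norm_num)
  have h0 : Real.sqrt 3 ≠ 0 := by positivity
  field_simp
  nlinarith

theorem eight_div : 8 / (9 * Real.sqrt 3) = 8 / 27 * Real.sqrt 3 := by
  have h : Real.sqrt 3 * Real.sqrt 3 = 3 := Real.mul_self_sqrt (by norm_num)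
  have h0 : Real.sqrt 3 ≠ 0 := by positivity
  field_simp
  nlinarith

theorem planeMap_zero_corner : planeMap 0 (corner 0) = corner 0 := by
  simp [planeMap, corner]

theorem planeMap_one_corner : planeMap 1 (corner 0) = corner 0 := by
  simp [planeMap, corner]

theorem planeMap_two_corner : planeMap 2 (corner 1) = corner 1 := by
  ext
  · norm_num [planeMap, corner]
  · simp only [planeMap, corner, sqrt_three_div]
    ring

theorem planeMap_three_corner : planeMap 3 (corner 2) = corner 2 := by
  ext
  · norm_num [planeMap, corner]
  · simp only [planeMap, corner, sqrt_three_div]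
    ring

/-- `F₀(q₂) = F₂(q₁)`. -/
theorem planeMap_glue_left : planeMap 0 (corner 1) = planeMap 2 (corner 0) := by
  have h : Real.sqrt 3 * Real.sqrt 3 = 3 := Real.mul_self_sqrt (by norm_num)
  ext
  · simp only [planeMap, corner, eight_div]
    nlinarith
  · simp only [planeMap, corner, sqrt_three_div]
    ring

/-- `F₁(q₃) = F₃(q₁)`. -/
theorem planeMap_glue_right : planeMap 1 (corner 2) = planeMap 3 (corner 0) := by
  have h : Real.sqrt 3 * Real.sqrt 3 = 3 := Real.mul_self_sqrt (by norm_num)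
  ext
  · simp only [planeMap, corner, eight_div]
    nlinarith
  · simp only [planeMap, corner, sqrt_three_div]
    ring

theorem planeMap_dist_le (i : Fin 4) (p q : ℝ × ℝ) :
    dist (planeMap i p) (planeMap i q) ≤ 3 / 4 * dist p q := by
  have h3 : Real.sqrt 3 ≤ 7 / 4 := by
    rw [Real.sqrt_le_left (by norm_num)]
    norm_num
  have h30 : 0 ≤ Real.sqrt 3 := Real.sqrt_nonneg 3
  obtain ⟨a, b⟩ := p
  obtain ⟨c, d⟩ := q
  rw [Prod.dist_eq, Prod.dist_eq]
  have h1 : |a - c| ≤ max (dist a c) (dist b d) := le_max_left (dist a c) (dist b d)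
  have h2 : |b - d| ≤ max (dist a c) (dist b d) := le_max_right (dist a c) (dist b d)
  generalize max (dist a c) (dist b d) = D at h1 h2
  have hD : 0 ≤ D := (abs_nonneg _).trans h1
  have hs : |Real.sqrt 3 * (b - d)| ≤ 7 / 4 * D := by
    rw [abs_mul, abs_of_nonneg h30]
    exact mul_le_mul h3 h2 (abs_nonneg _) (by norm_num)
  rw [abs_le] at h1 h2 hs
  refine max_le ?_ ?_ <;> rw [Real.dist_eq, abs_le] <;>
    fin_cases i <;> simp only [planeMap, eight_div] <;> constructor <;> nlinarith

theorem planeMap_continuous (i : Fin 4) : Continuous (planeMap i) :=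
  (LipschitzWith.of_dist_le_mul (K := 3 / 4) (fun p q => by
    simpa using planeMap_dist_le i p q)).continuous

theorem vertexSet_subset_box (n : ℕ) :
    vertexSet n ⊆ Set.Icc (-1) 1 ×ˢ Set.Icc (-(Real.sqrt 3 / 2)) 0 := by
  have h : Real.sqrt 3 * Real.sqrt 3 = 3 := Real.mul_self_sqrt (by norm_num)
  have h30 : 0 ≤ Real.sqrt 3 := Real.sqrt_nonneg 3
  induction n with
  | zero =>
    rintro _ ⟨j, rfl⟩
    have h2 : 0 ≤ Real.sqrt 3 / 2 := by positivity
    fin_cases j <;> simp [corner, h2]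
  | succ n ih =>
    rintro p hp
    obtain ⟨i, ⟨a, b⟩, hq, rfl⟩ := Set.mem_iUnion.1 hp
    obtain ⟨⟨h1, h2⟩, h3, h4⟩ := ih hq
    simp only at h1 h2 h3 h4
    have h5 : Real.sqrt 3 * b ≤ 0 := mul_nonpos_of_nonneg_of_nonpos h30 h4
    have h6 : -(3 / 2) ≤ Real.sqrt 3 * b := by nlinarith
    fin_cases i <;> simp only [planeMap, eight_div, sqrt_three_div] <;>
      refine ⟨⟨?_, ?_⟩, ?_, ?_⟩ <;> simp only <;> nlinarith

theorem vertexSet_subset_succ (n : ℕ) : vertexSet n ⊆ vertexSet (n + 1) := by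
  induction n with
  | zero =>
    rintro _ ⟨j, rfl⟩
    refine Set.mem_iUnion.2 ?_
    fin_cases j
    · exact ⟨0, corner 0, ⟨0, rfl⟩, planeMap_zero_corner⟩
    · exact ⟨2, corner 1, ⟨1, rfl⟩, planeMap_two_corner⟩
    · exact ⟨3, corner 2, ⟨2, rfl⟩, planeMap_three_corner⟩
  | succ n ih => exact Set.iUnion_mono fun i => Set.image_mono ih

theorem corner_mem (j : Fin 3) : corner j ∈ fractalSet :=
  subset_closure (Set.mem_iUnion.2 ⟨0, j, rfl⟩)

theorem fractalSet_isCompact : IsCompact fractalSet := by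
  have hb : IsCompact (Set.Icc (-1 : ℝ) 1 ×ˢ Set.Icc (-(Real.sqrt 3 / 2)) 0) :=
    isCompact_Icc.prod isCompact_Icc
  exact hb.of_isClosed_subset isClosed_closure
    (closure_minimal (Set.iUnion_subset vertexSet_subset_box) hb.isClosed)

theorem fractalSet_invariant : fractalSet = ⋃ i, planeMap i '' fractalSet := by
  apply Set.Subset.antisymm
  · refine closure_minimal (Set.iUnion_subset fun n => ?_)
      (isClosed_iUnion_of_finite fun i =>
        (fractalSet_isCompact.image (planeMap_continuous i)).isClosed)
    refine (vertexSet_subset_succ n).trans (Set.iUnion_mono fun i => Set.image_mono ?_)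
    exact (Set.subset_iUnion vertexSet n).trans subset_closure
  · refine Set.iUnion_subset fun i => ?_
    refine (image_closure_subset_closure_image (planeMap_continuous i)).trans (closure_mono ?_)
    rintro _ ⟨p, hp, rfl⟩
    obtain ⟨n, hn⟩ := Set.mem_iUnion.1 hp
    exact Set.mem_iUnion.2 ⟨n + 1, Set.mem_iUnion.2 ⟨i, p, hn, rfl⟩⟩

theorem subset_of_invariant {A B : Set (ℝ × ℝ)} (hA : IsCompact A) (hB : IsCompact B)
    (hBne : B.Nonempty) (hAi : A = ⋃ i, planeMap i '' A) (hBi : B = ⋃ i, planeMap i '' B) :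
    A ⊆ B := by
  rcases A.eq_empty_or_nonempty with rfl | hAne
  · exact Set.empty_subset B
  obtain ⟨a, ha, hmax⟩ := hA.exists_isMaxOn hAne (Metric.continuous_infDist_pt B).continuousOn
  have h1 : ∀ x ∈ A, Metric.infDist x B ≤ Metric.infDist a B := fun x hx => hmax hx
  have ha' := ha
  rw [hAi] at ha'
  obtain ⟨i, a', ha'A, rfl⟩ := Set.mem_iUnion.1 ha'
  obtain ⟨b, hb, hab⟩ := hB.exists_infDist_eq_dist hBne a'
  have hFb : planeMap i b ∈ B := by
    rw [hBi]
    exact Set.mem_iUnion.2 ⟨i, b, hb, rfl⟩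
  have h2 : Metric.infDist (planeMap i a') B ≤ 3 / 4 * Metric.infDist a' B := by
    rw [hab]
    exact (Metric.infDist_le_dist_of_mem hFb).trans (planeMap_dist_le i a' b)
  have h3 := h1 a' ha'A
  intro x hx
  have h4 := h1 x hx
  have h5 : Metric.infDist x B = 0 :=
    le_antisymm (by linarith [Metric.infDist_nonneg (x := a') (s := B)]) Metric.infDist_nonneg
  exact (hB.isClosed.mem_iff_infDist_zero hBne).2 h5

theorem fractalSet_unique {A : Set (ℝ × ℝ)} (hA : IsCompact A) (hne : A.Nonempty)
    (hAi : A = ⋃ i, planeMap i '' A) : A = fractalSet :=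
  Set.Subset.antisymm
    (subset_of_invariant hA fractalSet_isCompact ⟨_, corner_mem 0⟩ hAi fractalSet_invariant)
    (subset_of_invariant fractalSet_isCompact hA hne fractalSet_invariant hAi)

/-- The fractal `K` as a (compact) space. -/
abbrev K : Type := fractalSet

/-- The map `F_i : K → K`. -/
def F (i : Fin 4) (x : K) : K :=
  ⟨planeMap i x, fractalSet_invariant.ge (Set.mem_iUnion.2 ⟨i, x, x.2, rfl⟩)⟩

def q₁ : K := ⟨corner 0, corner_mem 0⟩
def q₂ : K := ⟨corner 1, corner_mem 1⟩
def q₃ : K := ⟨corner 2, corner_mem 2⟩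

/-- The point `q₀ = F₀(q₂) = F₂(q₁)`. -/
def q₀ : K := F 0 q₂

theorem q₀_eq : q₀ = F 2 q₁ := Subtype.ext planeMap_glue_left

/-- The resistance scaling factors `s₀ = s₁ = s₂ = s₃ = 1/2`. -/
def s (_ : Fin 4) : ℝ := 1 / 2

/-- The discrete energies
`E₀(u) = (u(q₁) - u(q₂))² + (u(q₁) - u(q₃))²` and `E_{n+1}(u) = ∑ i, s_i⁻¹ E_n(u ∘ F_i)`.
The value `E_n(u)` depends only on the restriction of `u` to `V_n`. -/
def discreteEnergy : ℕ → (K → ℝ) → ℝ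
  | 0, u => (u q₁ - u q₂) ^ 2 + (u q₁ - u q₃) ^ 2
  | n + 1, u => ∑ i, (s i)⁻¹ * discreteEnergy n (u ∘ F i)

/-- The energy `𝓔(u) = lim_n E_n(u) ∈ [0, ∞]` of a continuous function on `K`; the limit is a
supremum by `discreteEnergy_tendsto`. The domain of the Dirichlet form is
`{u ∈ C(K) | 𝓔(u) < ∞}`. -/
def energy (u : C(K, ℝ)) : ℝ≥0∞ := ⨆ n, ENNReal.ofReal (discreteEnergy n u)

theorem discreteEnergy_le_succ (n : ℕ) (u : K → ℝ) :
    discreteEnergy n u ≤ discreteEnergy (n + 1) u := by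
  induction n generalizing u with
  | zero =>
    have e0 : F 0 q₁ = q₁ := Subtype.ext planeMap_zero_corner
    have e1 : F 1 q₁ = q₁ := Subtype.ext planeMap_one_corner
    have e2 : F 2 q₂ = q₂ := Subtype.ext planeMap_two_corner
    have e3 : F 3 q₃ = q₃ := Subtype.ext planeMap_three_corner
    have e4 : F 0 q₂ = F 2 q₁ := Subtype.ext planeMap_glue_left
    have e5 : F 1 q₃ = F 3 q₁ := Subtype.ext planeMap_glue_right
    simp only [discreteEnergy, Fin.sum_univ_four, s, Function.comp_apply, e0, e1, e2, e3, e4, e5]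
    nlinarith [sq_nonneg (u q₁ - 2 * u (F 2 q₁) + u q₂), sq_nonneg (u q₁ - 2 * u (F 3 q₁) + u q₃),
      sq_nonneg (u q₁ - u (F 0 q₃)), sq_nonneg (u q₁ - u (F 1 q₂)),
      sq_nonneg (u (F 2 q₁) - u (F 2 q₃)), sq_nonneg (u (F 3 q₁) - u (F 3 q₂))]
  | succ n ih =>
    rw [discreteEnergy, discreteEnergy]
    refine Finset.sum_le_sum fun i _ => mul_le_mul_of_nonneg_left (ih _) ?_
    norm_num [s]

theorem discreteEnergy_tendsto (u : C(K, ℝ)) :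
    Filter.Tendsto (fun n => ENNReal.ofReal (discreteEnergy n u)) Filter.atTop (𝓝 (energy u)) :=
  tendsto_atTop_iSup (monotone_nat_of_le_succ fun n =>
    ENNReal.ofReal_le_ofReal (discreteEnergy_le_succ n u))

/-- The effective resistance `R(A, B) = 1 / inf {𝓔(u) | u = 0 on A, u = 1 on B}`, with
`1 / 0 = ∞` and `1 / ∞ = 0`; functions of infinite energy do not affect the infimum. -/
def resistance (A B : Set K) : ℝ≥0∞ :=
  (⨅ (u : C(K, ℝ)) (_ : ∀ x ∈ A, u x = 0) (_ : ∀ x ∈ B, u x = 1), energy u)⁻¹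

/-- The resistance metric `R(x, y) = R({x}, {y})`. -/
def R (x y : K) : ℝ≥0∞ := resistance {x} {y}

/-- The open ball `B_n = {x | R(x, q₀) < 2^{-n}}` of the resistance metric. -/
def ball (n : ℕ) : Set K := {x | R x q₀ < ENNReal.ofReal ((1 / 2) ^ n)}

end TreeFractal

end

/-!
`K` is a tree, and its resistance metric `resDist` (`R` with real values) can be computed cell by
cell: the maps `F i` scale it by `1/2` (`resDist_F`), and it is additive at the points `q₁`,
`F₀(q₂)`, `F₁(q₃)` that cut `K` into its cells (`IsCut.resDist_eq`). Both facts come from gluing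
functions on cells (`exists_glue`). As a consequence, the distances of the corners of a cell of
level `m ≥ 1` from `q₀` are integer multiples of `2 ^ (-m)`, and on the cell the distance from `q₀` is
largest at a corner (`exists_resDist_vertex_q₀`, `exists_resDist_cellMap_le_q₀`).

Write `r = R(x, q₀)` and `δ = 2 ^ (-n) - r`.

*Upper bounds.* At `q₀` the ball `B_n` has at least `2 ^ n` arms of length `2 ^ (-n)`; acting in
parallel they give `R(q₀, B_nᶜ) ≤ 2 ^ (-2n)`
(`EnergyLE.sq_le_of_eq_one_compl_ball`), hence `R(x, B_nᶜ) ≤ 2 (r + 2 ^ (-2n))`. On the other hand,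
the cell of level `m` around `x`, where `2 ^ (-m)` is the dyadic number just above `δ`, has a corner
`p` with `R(p, q₀) ≥ r > 2 ^ (-n) - 2 ^ (-m)`; as this is a multiple of `2 ^ (-m)`, the corner `p`
is outside `B_n`. So `R(x, B_nᶜ) ≤ R(x, p) ≤ 4 δ` if `r > 0` (`resistance_le_sub`); for `r = 0`
the first bound is enough.

*Lower bounds.* A vertex `p` that occurs first at level `l` has a bump function of energy at most
`8 * 2 ^ l` supported in the ball of radius `2 ^ (-l)` (`exists_bump_vertex`). By
divisibility this ball lies in `B_n` whenever `p` is in `B_n \ {q₀}`. Taking the maximum of the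
bump functions of the three corners of a cell around `x` of size comparable to `min r δ`, and
filling in the value `1` on the cell (`exists_fill`), shows `R(x, B_nᶜ) ≥ min r δ / 96`
(`le_resistance_of_pos`). This suffices unless `r` is small compared with `2 ^ (-2n)`; in that case
a bump function of `q₀` that vanishes off `B_n` and has energy at most `4 * 4 ^ n`
(`exists_bump_q₀`) is at least `1/2` at `x`, since it is Hölder continuous, and this gives the
bound of order `2 ^ (-2n)` (`le_resistance_of_lt`).
-/

namespace TreeFractal

/-! ### Cells and gluing -/

/-- The corners `q₁, q₂, q₃`, indexed by `0, 1, 2`. -/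
noncomputable def Q : Fin 3 → K := ![q₁, q₂, q₃]

@[simp] theorem Q_zero : Q 0 = q₁ := rfl
@[simp] theorem Q_one : Q 1 = q₂ := rfl
@[simp] theorem Q_two : Q 2 = q₃ := rfl

@[simp] theorem F_zero_q₁ : F 0 q₁ = q₁ := Subtype.ext planeMap_zero_corner
@[simp] theorem F_one_q₁ : F 1 q₁ = q₁ := Subtype.ext planeMap_one_corner
@[simp] theorem F_two_q₂ : F 2 q₂ = q₂ := Subtype.ext planeMap_two_corner
@[simp] theorem F_three_q₃ : F 3 q₃ = q₃ := Subtype.ext planeMap_three_corner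
theorem F_glue_left : F 0 q₂ = F 2 q₁ := Subtype.ext planeMap_glue_left
theorem F_glue_right : F 1 q₃ = F 3 q₁ := Subtype.ext planeMap_glue_right

theorem F_continuous (i : Fin 4) : Continuous (F i) :=
  ((planeMap_continuous i).comp continuous_subtype_val).subtype_mk _

theorem exists_F_eq (x : K) : ∃ i z, F i z = x := by
  obtain ⟨i, z, hz, h⟩ := Set.mem_iUnion.1 (fractalSet_invariant.le x.2)
  exact ⟨i, ⟨z, hz⟩, Subtype.ext h⟩

/-- The triangle with vertices `q₁, q₂, q₃` contains every `V_n`. -/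
theorem vertexSet_subset_triangle (n : ℕ) :
    vertexSet n ⊆ {p : ℝ × ℝ | p.2 ≤ 0 ∧ -(√3 / 2) ≤ p.2 ∧
      p.1 ≤ -(2 / 3 * √3 * p.2) ∧ 2 / 3 * √3 * p.2 ≤ p.1} := by
  have h : √3 * √3 = 3 := Real.mul_self_sqrt (by norm_num)
  have h30 : 0 ≤ √3 := Real.sqrt_nonneg 3
  induction n with
  | zero =>
    rintro _ ⟨j, rfl⟩
    fin_cases j <;> simp only [corner, Set.mem_ofPred_eq] <;> refine ⟨?_, ?_, ?_, ?_⟩ <;> nlinarith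
  | succ n ih =>
    rintro p hp
    obtain ⟨i, ⟨a, b⟩, hq, rfl⟩ := Set.mem_iUnion.1 hp
    obtain ⟨h1, h2, h3, h4⟩ := ih hq
    simp only at h1 h2 h3 h4
    have h5 : √3 * b ≤ 0 := mul_nonpos_of_nonneg_of_nonpos h30 h1
    have h6 : -(3 / 2) ≤ √3 * b := by nlinarith
    have h7 : √3 * (√3 * b) = 3 * b := by rw [← mul_assoc, h]
    fin_cases i <;> simp only [planeMap, eight_div, sqrt_three_div, Set.mem_ofPred_eq] <;>
      refine ⟨?_, ?_, ?_, ?_⟩ <;> nlinarith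

theorem mem_triangle (x : K) : x.1.2 ≤ 0 ∧ -(√3 / 2) ≤ x.1.2 ∧
    x.1.1 ≤ -(2 / 3 * √3 * x.1.2) ∧ 2 / 3 * √3 * x.1.2 ≤ x.1.1 := by
  have hc : IsClosed {p : ℝ × ℝ | p.2 ≤ 0 ∧ -(√3 / 2) ≤ p.2 ∧
      p.1 ≤ -(2 / 3 * √3 * p.2) ∧ 2 / 3 * √3 * p.2 ≤ p.1} := by
    refine (isClosed_le ?_ ?_).and ((isClosed_le ?_ ?_).and
      ((isClosed_le ?_ ?_).and (isClosed_le ?_ ?_))) <;> fun_prop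
  exact closure_minimal (Set.iUnion_subset vertexSet_subset_triangle) hc x.2

theorem F_injective (i : Fin 4) : Function.Injective (F i) := by
  rintro ⟨⟨a, b⟩, hx⟩ ⟨⟨c, d⟩, hy⟩ h
  have h' : planeMap i (a, b) = planeMap i (c, d) := congrArg Subtype.val h
  have h1 := congrArg Prod.fst h'
  have h2 := congrArg Prod.snd h'
  have hb : b = d := by
    fin_cases i <;> simp only [planeMap] at h2 <;>
      linarith
  subst hb
  have ha : a = c := by
    fin_cases i <;> simp only [planeMap] at h1 <;>
      linarith
  subst ha
  rfl

theorem eq_q₁ {x : K} (h : x.1.2 = 0) : x = q₁ := by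
  obtain ⟨_, _, h3, h4⟩ := mem_triangle x
  refine Subtype.ext (Prod.ext ?_ ?_)
  · rw [h] at h3 h4
    simp only [q₁, corner]
    linarith
  · simpa [q₁, corner] using h

theorem F_zero_eq_F_one {x y : K} (h : F 0 x = F 1 y) : x = q₁ ∧ y = q₁ := by
  have h' : planeMap 0 x.1 = planeMap 1 y.1 := congrArg Subtype.val h
  have h1 := congrArg Prod.fst h'
  have h2 := congrArg Prod.snd h'
  simp only [planeMap, eight_div] at h1 h2
  obtain ⟨hx1, _, hx3, _⟩ := mem_triangle x
  obtain ⟨_, _, _, hy4⟩ := mem_triangle y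
  have hs : 0 < √3 := by positivity
  have e : x.1.2 = y.1.2 := by linarith
  rw [← e] at h1 hy4
  have : 0 ≤ √3 * x.1.2 := by nlinarith
  have h0 : x.1.2 = 0 := le_antisymm hx1 (nonneg_of_mul_nonneg_right this hs)
  exact ⟨eq_q₁ h0, eq_q₁ (e ▸ h0)⟩

theorem F_zero_eq_F_two {x y : K} (h : F 0 x = F 2 y) : x = q₂ ∧ y = q₁ := by
  have h' : planeMap 0 x.1 = planeMap 2 y.1 := congrArg Subtype.val h
  have h2 := congrArg Prod.snd h'
  simp only [planeMap, sqrt_three_div] at h2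
  obtain ⟨_, hx2, _, _⟩ := mem_triangle x
  obtain ⟨hy1, _, _, _⟩ := mem_triangle y
  have hy : y = q₁ := eq_q₁ (by linarith)
  subst hy
  exact ⟨F_injective 0 (h.trans F_glue_left.symm), rfl⟩

theorem F_one_eq_F_three {x y : K} (h : F 1 x = F 3 y) : x = q₃ ∧ y = q₁ := by
  have h' : planeMap 1 x.1 = planeMap 3 y.1 := congrArg Subtype.val h
  have h2 := congrArg Prod.snd h'
  simp only [planeMap, sqrt_three_div] at h2
  obtain ⟨_, hx2, _, _⟩ := mem_triangle x
  obtain ⟨hy1, _, _, _⟩ := mem_triangle y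
  have hy : y = q₁ := eq_q₁ (by linarith)
  subst hy
  exact ⟨F_injective 1 (h.trans F_glue_right.symm), rfl⟩

theorem F_zero_ne_F_three (x y : K) : F 0 x ≠ F 3 y := by
  intro h
  have h' : planeMap 0 x.1 = planeMap 3 y.1 := congrArg Subtype.val h
  have h1 := congrArg Prod.fst h'
  have h2 := congrArg Prod.snd h'
  simp only [planeMap, sqrt_three_div, eight_div] at h1 h2
  obtain ⟨hx1, hx2, hx3, hx4⟩ := mem_triangle x
  obtain ⟨hy1, hy2, hy3, hy4⟩ := mem_triangle y
  have hs : √3 * √3 = 3 := Real.mul_self_sqrt (by norm_num)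
  have hs0 : 0 ≤ √3 := Real.sqrt_nonneg 3
  have := mul_nonpos_of_nonneg_of_nonpos hs0 hx1
  have : -(3 / 2) ≤ √3 * y.1.2 := by nlinarith
  nlinarith

theorem F_one_ne_F_two (x y : K) : F 1 x ≠ F 2 y := by
  intro h
  have h' : planeMap 1 x.1 = planeMap 2 y.1 := congrArg Subtype.val h
  have h1 := congrArg Prod.fst h'
  have h2 := congrArg Prod.snd h'
  simp only [planeMap, sqrt_three_div, eight_div] at h1 h2
  obtain ⟨hx1, hx2, hx3, hx4⟩ := mem_triangle x
  obtain ⟨hy1, hy2, hy3, hy4⟩ := mem_triangle y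
  have hs : √3 * √3 = 3 := Real.mul_self_sqrt (by norm_num)
  have hs0 : 0 ≤ √3 := Real.sqrt_nonneg 3
  have := mul_nonpos_of_nonneg_of_nonpos hs0 hx1
  have : -(3 / 2) ≤ √3 * y.1.2 := by nlinarith
  nlinarith

theorem F_two_ne_F_three (x y : K) : F 2 x ≠ F 3 y := by
  intro h
  have h' : planeMap 2 x.1 = planeMap 3 y.1 := congrArg Subtype.val h
  have h1 := congrArg Prod.fst h'
  simp only [planeMap] at h1
  obtain ⟨hx1, hx2, hx3, hx4⟩ := mem_triangle x
  obtain ⟨hy1, hy2, hy3, hy4⟩ := mem_triangle y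
  have hs : √3 * √3 = 3 := Real.mul_self_sqrt (by norm_num)
  have hs0 : 0 ≤ √3 := Real.sqrt_nonneg 3
  have : -(3 / 2) ≤ √3 * x.1.2 := by nlinarith
  have : -(3 / 2) ≤ √3 * y.1.2 := by nlinarith
  linarith

/-- Four functions, one on each cell `F_i(K)`, that agree at the three junctions
`q₁`, `F₀(q₂) = F₂(q₁)` and `F₁(q₃) = F₃(q₁)` of the cells. -/
structure Compatible (v : Fin 4 → C(K, ℝ)) : Prop where
  top : v 0 q₁ = v 1 q₁
  left : v 0 q₂ = v 2 q₁
  right : v 1 q₃ = v 3 q₁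

theorem Compatible.eq_of_F_eq {v : Fin 4 → C(K, ℝ)} (hv : Compatible v) {i j : Fin 4} {x y : K}
    (h : F i x = F j y) : v i x = v j y := by
  wlog hij : i ≤ j generalizing i j x y
  · exact (this h.symm (le_of_not_ge hij)).symm
  rcases hij.eq_or_lt with rfl | hij
  · rw [F_injective i h]
  fin_cases i <;> fin_cases j <;> simp only [Fin.reduceFinMk, Fin.mk_one, Fin.zero_eta] at h hij ⊢
    <;> try exact absurd hij (by decide)
  · obtain ⟨rfl, rfl⟩ := F_zero_eq_F_one h
    exact hv.top
  · obtain ⟨rfl, rfl⟩ := F_zero_eq_F_two h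
    exact hv.left
  · exact absurd h (F_zero_ne_F_three _ _)
  · exact absurd h (F_one_ne_F_two _ _)
  · obtain ⟨rfl, rfl⟩ := F_one_eq_F_three h
    exact hv.right
  · exact absurd h (F_two_ne_F_three _ _)

instance : CompactSpace K := isCompact_iff_compactSpace.1 fractalSet_isCompact

/-- Compatible continuous functions on the four cells glue to a continuous function on `K`. -/
theorem exists_glue {v : Fin 4 → C(K, ℝ)} (hv : Compatible v) :
    ∃ u : C(K, ℝ), ∀ i z, u (F i z) = v i z := by
  choose idx pre hpre using exists_F_eq
  let g : K → ℝ := fun x => v (idx x) (pre x)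
  have hg : ∀ i z, g (F i z) = v i z := fun i z => hv.eq_of_F_eq (hpre _)
  refine ⟨⟨g, continuous_iff_isClosed.2 fun C hC => ?_⟩, hg⟩
  have : g ⁻¹' C = ⋃ i, F i '' (v i ⁻¹' C) := by
    ext x
    constructor
    · intro hx
      exact Set.mem_iUnion.2 ⟨idx x, pre x, hx, hpre x⟩
    · intro hx
      obtain ⟨i, z, hz, rfl⟩ := Set.mem_iUnion.1 hx
      simpa only [Set.mem_preimage, hg] using hz
  rw [this]
  exact isClosed_iUnion_of_finite fun i =>
    (((hC.preimage (v i).continuous).isCompact).image (F_continuous i)).isClosed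

/-- The map `F_w = F_{w₁} ∘ ⋯ ∘ F_{w_m}` of a word `w = w₁ ⋯ w_m`. -/
noncomputable def cellMap : List (Fin 4) → K → K
  | [], x => x
  | i :: w, x => F i (cellMap w x)

theorem exists_cellMap_eq (m : ℕ) (x : K) : ∃ w z, w.length = m ∧ cellMap w z = x := by
  induction m generalizing x with
  | zero => exact ⟨[], x, rfl, rfl⟩
  | succ m ih =>
    obtain ⟨i, y, rfl⟩ := exists_F_eq x
    obtain ⟨w, z, hw, rfl⟩ := ih y
    exact ⟨i :: w, z, by simp [hw], rfl⟩

theorem dist_cellMap_le (w : List (Fin 4)) (x y : K) :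
    dist (cellMap w x) (cellMap w y) ≤ (3 / 4) ^ w.length * dist x y := by
  induction w with
  | nil => simp [cellMap]
  | cons i w ih =>
    refine (planeMap_dist_le i _ _).trans ?_
    rw [List.length_cons, pow_succ, mul_comm _ (3 / 4 : ℝ), mul_assoc]
    exact mul_le_mul_of_nonneg_left ih (by norm_num)

/-! ### Discrete energies -/

theorem discreteEnergy_succ (n : ℕ) (u : K → ℝ) :
    discreteEnergy (n + 1) u = 2 * discreteEnergy n (u ∘ F 0) + 2 * discreteEnergy n (u ∘ F 1) +
      2 * discreteEnergy n (u ∘ F 2) + 2 * discreteEnergy n (u ∘ F 3) := by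
  simp [discreteEnergy, Fin.sum_univ_four, s]

theorem discreteEnergy_succ_sum (n : ℕ) (u : K → ℝ) :
    discreteEnergy (n + 1) u = 2 * ∑ i, discreteEnergy n (u ∘ F i) := by
  simp [discreteEnergy, s, Finset.mul_sum]

theorem discreteEnergy_nonneg (n : ℕ) (u : K → ℝ) : 0 ≤ discreteEnergy n u := by
  induction n generalizing u with
  | zero => simp only [discreteEnergy]; positivity
  | succ n ih =>
    rw [discreteEnergy_succ_sum]
    exact mul_nonneg zero_le_two (Finset.sum_nonneg fun i _ => ih _)

theorem discreteEnergy_comp_F_le (n : ℕ) (i : Fin 4) (u : K → ℝ) :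
    2 * discreteEnergy n (u ∘ F i) ≤ discreteEnergy (n + 1) u := by
  rw [discreteEnergy_succ_sum]
  exact mul_le_mul_of_nonneg_left
    (Finset.single_le_sum (f := fun i => discreteEnergy n (u ∘ F i))
      (fun i _ => discreteEnergy_nonneg n _) (Finset.mem_univ i)) zero_le_two

theorem discreteEnergy_affine (n : ℕ) (a b : ℝ) (u : K → ℝ) :
    discreteEnergy n (fun x => a * u x + b) = a ^ 2 * discreteEnergy n u := by
  induction n generalizing u with
  | zero => simp only [discreteEnergy]; ring
  | succ n ih =>
    have := fun i => ih (u ∘ F i)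
    simp only [discreteEnergy_succ]
    simp only [Function.comp_def] at this ⊢
    rw [this 0, this 1, this 2, this 3]
    ring

/-- A bound on squared increments of functions carries over to the discrete energies, which are
sums of squared increments. -/
theorem discreteEnergy_add_le {u v f g : K → ℝ}
    (h : ∀ x y, (u x - u y) ^ 2 + (v x - v y) ^ 2 ≤ (f x - f y) ^ 2 + (g x - g y) ^ 2) (n : ℕ) :
    discreteEnergy n u + discreteEnergy n v ≤ discreteEnergy n f + discreteEnergy n g := by
  induction n generalizing u v f g with
  | zero =>
    simp only [discreteEnergy]
    linarith [h q₁ q₂, h q₁ q₃]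
  | succ n ih =>
    have := fun i => ih (u := u ∘ F i) (v := v ∘ F i) (f := f ∘ F i) (g := g ∘ F i)
      (fun x y => h _ _)
    simp only [discreteEnergy_succ]
    linarith [this 0, this 1, this 2, this 3]

theorem discreteEnergy_const (n : ℕ) (c : ℝ) : discreteEnergy n (fun _ => c) = 0 := by
  simpa using discreteEnergy_affine n 0 c fun _ => c

theorem discreteEnergy_mono (u : K → ℝ) : Monotone fun n => discreteEnergy n u :=
  monotone_nat_of_le_succ fun n => discreteEnergy_le_succ n u

/-- The energy of `u` is at most the real number `e`. -/
def EnergyLE (u : K → ℝ) (e : ℝ) : Prop := ∀ n, discreteEnergy n u ≤ e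

theorem EnergyLE.nonneg {u : K → ℝ} {e : ℝ} (h : EnergyLE u e) : 0 ≤ e :=
  (discreteEnergy_nonneg 0 u).trans (h 0)

theorem EnergyLE.mono {u : K → ℝ} {e e' : ℝ} (h : EnergyLE u e) (he : e ≤ e') : EnergyLE u e' :=
  fun n => (h n).trans he

theorem EnergyLE.const (c : ℝ) : EnergyLE (fun _ => c) 0 := fun n => (discreteEnergy_const n c).le

theorem EnergyLE.affine {u : K → ℝ} {e : ℝ} (h : EnergyLE u e) (a b : ℝ) :
    EnergyLE (fun x => a * u x + b) (a ^ 2 * e) := fun n => by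
  rw [discreteEnergy_affine]
  exact mul_le_mul_of_nonneg_left (h n) (sq_nonneg a)

theorem EnergyLE.comp_F {u : K → ℝ} {e : ℝ} (h : EnergyLE u e) (i : Fin 4) :
    EnergyLE (u ∘ F i) (e / 2) := fun n => by
  linarith [discreteEnergy_comp_F_le n i u, h (n + 1)]

theorem EnergyLE.of_cells {u : K → ℝ} {e : Fin 4 → ℝ} (h : ∀ i, EnergyLE (u ∘ F i) (e i)) :
    EnergyLE u (2 * ∑ i, e i) := by
  have : ∀ n, discreteEnergy (n + 1) u ≤ 2 * ∑ i, e i := fun n => by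
    rw [discreteEnergy_succ_sum]
    exact mul_le_mul_of_nonneg_left (Finset.sum_le_sum fun i _ => h i n) zero_le_two
  exact fun n => (discreteEnergy_le_succ n u).trans (this n)

/-- Gluing with control of the energy. -/
theorem exists_glue_energyLE {v : Fin 4 → C(K, ℝ)} {e : Fin 4 → ℝ} (hv : Compatible v)
    (he : ∀ i, EnergyLE (v i) (e i)) :
    ∃ u : C(K, ℝ), (∀ i z, u (F i z) = v i z) ∧ EnergyLE u (2 * (e 0 + e 1 + e 2 + e 3)) := by
  obtain ⟨u, hu⟩ := exists_glue hv
  refine ⟨u, hu, ?_⟩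
  rw [← Fin.sum_univ_four]
  refine EnergyLE.of_cells fun i => ?_
  have : u ∘ F i = v i := funext fun z => hu i z
  rw [this]
  exact he i

/-- If the squared increments of `u` and `v` add up to at most those of `f`, then so do the
energies. -/
theorem EnergyLE.exists_split {u v f : K → ℝ} {e : ℝ} (hf : EnergyLE f e)
    (h : ∀ x y, (u x - u y) ^ 2 + (v x - v y) ^ 2 ≤ (f x - f y) ^ 2) :
    ∃ a b, EnergyLE u a ∧ EnergyLE v b ∧ a + b ≤ e := by
  have hsum : ∀ n, discreteEnergy n u + discreteEnergy n v ≤ e := fun n => by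
    have := discreteEnergy_add_le (u := u) (v := v) (f := f) (g := fun _ => 0)
      (fun x y => by simpa using h x y) n
    rw [discreteEnergy_const, add_zero] at this
    exact this.trans (hf n)
  have hu : BddAbove (Set.range fun n => discreteEnergy n u) := ⟨e, by
    rintro _ ⟨n, rfl⟩
    exact (le_add_of_nonneg_right (discreteEnergy_nonneg n v)).trans (hsum n)⟩
  have hv : BddAbove (Set.range fun n => discreteEnergy n v) := ⟨e, by
    rintro _ ⟨n, rfl⟩
    exact (le_add_of_nonneg_left (discreteEnergy_nonneg n u)).trans (hsum n)⟩
  exact ⟨_, _, fun n => le_ciSup hu n, fun n => le_ciSup hv n,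
    le_of_tendsto' ((tendsto_atTop_ciSup (discreteEnergy_mono u) hu).add
      (tendsto_atTop_ciSup (discreteEnergy_mono v) hv)) hsum⟩

theorem EnergyLE.sup {u v : K → ℝ} {a b : ℝ} (hu : EnergyLE u a) (hv : EnergyLE v b) :
    EnergyLE (fun x => max (u x) (v x)) (a + b) := fun n => by
  have := discreteEnergy_add_le (u := fun x => max (u x) (v x)) (v := fun _ => 0) (f := u) (g := v)
    (fun x y => by
      rw [sub_zero, zero_pow two_ne_zero, add_zero]
      rcases le_max_iff.1 (abs_max_sub_max_le_max (u x) (v x) (u y) (v y)) with h | h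
      · linarith [sq_le_sq.2 h, sq_nonneg (v x - v y)]
      · linarith [sq_le_sq.2 h, sq_nonneg (u x - u y)]) n
  rw [discreteEnergy_const, add_zero] at this
  linarith [hu n, hv n]

theorem sq_min_add_sq_max_le (a b t : ℝ) :
    (min a t - min b t) ^ 2 + (max a t - max b t) ^ 2 ≤ (a - b) ^ 2 := by
  rcases le_total a t with h1 | h1 <;> rcases le_total b t with h2 | h2 <;>
    simp only [min_eq_left, min_eq_right, max_eq_left, max_eq_right, h1, h2] <;> nlinarith

theorem EnergyLE.min_const {u : K → ℝ} {e : ℝ} (hu : EnergyLE u e) (t : ℝ) :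
    EnergyLE (fun x => min (u x) t) e := fun n => by
  have := discreteEnergy_add_le (u := fun x => min (u x) t) (v := fun x => max (u x) t) (f := u)
    (g := fun _ => 0) (fun x y => by simpa using sq_min_add_sq_max_le (u x) (u y) t) n
  rw [discreteEnergy_const, add_zero] at this
  linarith [hu n, discreteEnergy_nonneg n fun x => max (u x) t]

/-! ### Self-similar functions -/

/-- An affine function with prescribed values at the corners. -/
theorem exists_corner_values (c : Fin 3 → ℝ) : ∃ u : C(K, ℝ), ∀ j, u (Q j) = c j := by
  have hs : √3 ≠ 0 := by positivity
  refine ⟨⟨fun x => c 0 + (c 2 - c 1) / 2 * x.1.1 +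
    (2 * c 0 - c 1 - c 2) / √3 * x.1.2, by fun_prop⟩, fun j => ?_⟩
  fin_cases j <;> simp [q₁, q₂, q₃, corner] <;> field_simp <;> ring

/-- A system of affine maps `t ↦ a i * t + b i` that contract by `1/2` and are compatible with the
junctions has a continuous solution of `u ∘ F i = a i * u + b i`. -/
theorem exists_selfSimilar {a b : Fin 4 → ℝ} {c : Fin 3 → ℝ} (ha : ∀ i, |a i| ≤ 1 / 2)
    (h0 : a 0 * c 0 + b 0 = c 0) (h1 : a 1 * c 0 + b 1 = c 0)
    (h2 : a 2 * c 1 + b 2 = c 1) (h3 : a 3 * c 2 + b 3 = c 2)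
    (hl : a 0 * c 1 + b 0 = a 2 * c 0 + b 2) (hr : a 1 * c 2 + b 1 = a 3 * c 0 + b 3) :
    ∃ u : C(K, ℝ), (∀ j, u (Q j) = c j) ∧ ∀ i z, u (F i z) = a i * u z + b i := by
  let X := {u : C(K, ℝ) // ∀ j, u (Q j) = c j}
  have hcl : IsClosed {u : C(K, ℝ) | ∀ j, u (Q j) = c j} := by
    simp only [Set.ofPred_forall]
    exact isClosed_iInter fun j =>
      isClosed_eq (continuous_eval_const (Q j)) continuous_const
  have : CompleteSpace X := hcl.completeSpace_coe
  obtain ⟨u0, hu0⟩ := exists_corner_values c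
  have : Nonempty X := ⟨⟨u0, hu0⟩⟩
  have hT : ∀ u : X, ∃ v : X, ∀ i z, v.1 (F i z) = a i * u.1 z + b i := by
    rintro ⟨u, hu⟩
    have e0 := hu 0
    have e1 := hu 1
    have e2 := hu 2
    simp only [Q_zero, Q_one, Q_two] at e0 e1 e2
    let v : Fin 4 → C(K, ℝ) := fun i => ⟨fun z => a i * u z + b i, by fun_prop⟩
    have hv : Compatible v := by
      refine ⟨?_, ?_, ?_⟩ <;> simp only [v, ContinuousMap.coe_mk, e0, e1, e2, h0, h1, hl, hr]
    obtain ⟨g, hg⟩ := exists_glue hv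
    refine ⟨⟨g, fun j => ?_⟩, hg⟩
    have g0 := hg 0 q₁
    have g2 := hg 2 q₂
    have g3 := hg 3 q₃
    simp only [F_zero_q₁, F_two_q₂, F_three_q₃, v, ContinuousMap.coe_mk, e0, e1, e2, h0, h2, h3]
      at g0 g2 g3
    fin_cases j
    exacts [g0, g2, g3]
  choose T hTF using hT
  have hc : ContractingWith (1 / 2) T := by
    refine ⟨by rw [← NNReal.coe_lt_coe]; norm_num, LipschitzWith.of_dist_le_mul fun u v => ?_⟩
    rw [Subtype.dist_eq, Subtype.dist_eq, ContinuousMap.dist_le (by positivity)]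
    intro x
    obtain ⟨i, z, rfl⟩ := exists_F_eq x
    rw [hTF, hTF, Real.dist_eq, add_sub_add_right_eq_sub, ← mul_sub, abs_mul]
    refine mul_le_mul ((ha i).trans (by norm_num)) ?_ (abs_nonneg _) (by positivity)
    exact ContinuousMap.dist_apply_le_dist (f := u.1) (g := v.1) z
  let u := ContractingWith.fixedPoint T hc
  have hu : T u = u := hc.fixedPoint_isFixedPt
  refine ⟨u.1, u.2, fun i z => ?_⟩
  conv_lhs => rw [← hu]
  exact hTF u i z

theorem discreteEnergy_selfSimilar {a b : Fin 4 → ℝ} {u : C(K, ℝ)}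
    (hu : ∀ i z, u (F i z) = a i * u z + b i) (n : ℕ) :
    discreteEnergy (n + 1) u =
      2 * (a 0 ^ 2 + a 1 ^ 2 + a 2 ^ 2 + a 3 ^ 2) * discreteEnergy n u := by
  have : ∀ i, u ∘ F i = fun z => a i * u z + b i := fun i => funext fun z => hu i z
  simp only [discreteEnergy_succ, this, discreteEnergy_affine]
  ring

/-- The harmonic function with values `0, 1, 0` at `q₁, q₂, q₃`, of energy `1`. -/
theorem exists_harmonic_left : ∃ u : C(K, ℝ), u q₁ = 0 ∧ u q₂ = 1 ∧ u q₃ = 0 ∧ EnergyLE u 1 := by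
  obtain ⟨u, hc, hu⟩ := exists_selfSimilar (a := ![1 / 2, 0, 1 / 2, 0]) (b := ![0, 0, 1 / 2, 0])
    (c := ![0, 1, 0]) (fun i => by fin_cases i <;> norm_num)
    (by simp) (by simp) (by simp; norm_num) (by simp) (by simp) (by simp)
  have e0 : u q₁ = 0 := hc 0
  have e1 : u q₂ = 1 := hc 1
  have e2 : u q₃ = 0 := hc 2
  refine ⟨u, e0, e1, e2, fun n => ?_⟩
  induction n with
  | zero => simp [discreteEnergy, e0, e1, e2]
  | succ n ih =>
    rw [discreteEnergy_selfSimilar hu]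
    simp only [Matrix.cons_val]
    linarith

/-- The harmonic function with values `0, 0, 1` at `q₁, q₂, q₃`, of energy `1`. -/
theorem exists_harmonic_right : ∃ u : C(K, ℝ), u q₁ = 0 ∧ u q₂ = 0 ∧ u q₃ = 1 ∧ EnergyLE u 1 := by
  obtain ⟨u, hc, hu⟩ := exists_selfSimilar (a := ![0, 1 / 2, 0, 1 / 2]) (b := ![0, 0, 0, 1 / 2])
    (c := ![0, 0, 1]) (fun i => by fin_cases i <;> norm_num)
    (by simp) (by simp) (by simp) (by simp; norm_num) (by simp) (by simp)
  have e0 : u q₁ = 0 := hc 0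
  have e1 : u q₂ = 0 := hc 1
  have e2 : u q₃ = 1 := hc 2
  refine ⟨u, e0, e1, e2, fun n => ?_⟩
  induction n with
  | zero => simp [discreteEnergy, e0, e1, e2]
  | succ n ih =>
    rw [discreteEnergy_selfSimilar hu]
    simp only [Matrix.cons_val]
    linarith

/-! ### The resistance metric -/

theorem energy_le {u : C(K, ℝ)} {e : ℝ} (h : EnergyLE u e) : energy u ≤ ENNReal.ofReal e :=
  iSup_le fun n => ENNReal.ofReal_le_ofReal (h n)

theorem energyLE_toReal {u : C(K, ℝ)} (h : energy u ≠ ∞) : EnergyLE u (energy u).toReal :=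
  fun n => (ENNReal.ofReal_le_iff_le_toReal h).1
    (le_iSup (fun n => ENNReal.ofReal (discreteEnergy n u)) n)

theorem resistance_le {A B : Set K} {a : ℝ} (ha : 0 ≤ a)
    (h : ∀ (u : C(K, ℝ)) (e : ℝ), (∀ x ∈ A, u x = 0) → (∀ x ∈ B, u x = 1) → EnergyLE u e →
      1 ≤ a * e) : resistance A B ≤ ENNReal.ofReal a := by
  rw [resistance, ENNReal.inv_le_iff_inv_le]
  refine le_iInf fun u => le_iInf fun hA => le_iInf fun hB => ?_
  by_cases hu : energy u = ∞
  · rw [hu]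
    exact le_top
  have h1 := h u _ hA hB (energyLE_toReal hu)
  have ha' : 0 < a := by
    rcases ha.eq_or_lt with rfl | h'
    · norm_num at h1
    · exact h'
  rw [← ENNReal.ofReal_inv_of_pos ha', ← ENNReal.ofReal_toReal hu]
  refine ENNReal.ofReal_le_ofReal ?_
  rwa [inv_le_iff_one_le_mul₀' ha']

theorem le_resistance {A B : Set K} {u : C(K, ℝ)} {e : ℝ} (he : 0 < e)
    (hA : ∀ x ∈ A, u x = 0) (hB : ∀ x ∈ B, u x = 1) (hu : EnergyLE u e) :
    ENNReal.ofReal e⁻¹ ≤ resistance A B := by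
  rw [resistance, ENNReal.ofReal_inv_of_pos he, ENNReal.inv_le_inv]
  exact (iInf_le_of_le u (iInf_le_of_le hA (iInf_le_of_le hB le_rfl))).trans (energy_le hu)

theorem sq_sub_q₁_le_discreteEnergy (w : List (Fin 4)) (j : Fin 3) (u : K → ℝ) :
    (u (cellMap w (Q j)) - u q₁) ^ 2 ≤ discreteEnergy w.length u := by
  induction w generalizing u with
  | nil =>
    simp only [cellMap, List.length_nil, discreteEnergy]
    fin_cases j <;> simp <;> nlinarith [sq_nonneg (u q₁ - u q₂), sq_nonneg (u q₁ - u q₃)]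
  | cons i w ih =>
    have hn := fun i => discreteEnergy_nonneg w.length (u ∘ F i)
    have e0 : discreteEnergy 0 (u ∘ F 0) ≤ _ := discreteEnergy_mono _ (Nat.zero_le w.length)
    have e1 : discreteEnergy 0 (u ∘ F 1) ≤ _ := discreteEnergy_mono _ (Nat.zero_le w.length)
    have hi := ih (u ∘ F i)
    simp only [cellMap, List.length_cons, discreteEnergy_succ, Function.comp_apply, discreteEnergy,
      F_zero_q₁, F_one_q₁, F_glue_left, F_glue_right] at *
    fin_cases i <;> simp only [Fin.reduceFinMk, Fin.mk_one, Fin.zero_eta, F_zero_q₁, F_one_q₁]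
      at hi ⊢
    · nlinarith [hn 0, hn 1, hn 2, hn 3]
    · nlinarith [hn 0, hn 1, hn 2, hn 3]
    · nlinarith [hn 0, hn 1, hn 2, hn 3, sq_nonneg (u q₁ - u (F 0 q₃)),
        sq_nonneg (u (F 2 (cellMap w (Q j))) - u (F 2 q₁) + (u q₁ - u (F 2 q₁)))]
    · nlinarith [hn 0, hn 1, hn 2, hn 3, sq_nonneg (u q₁ - u (F 1 q₂)),
        sq_nonneg (u (F 3 (cellMap w (Q j))) - u (F 3 q₁) + (u q₁ - u (F 3 q₁)))]

theorem dense_vertices : Dense {x | ∃ w, cellMap w q₁ = x} := by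
  intro x
  rw [Metric.mem_closure_iff]
  intro ε hε
  obtain ⟨D, hD⟩ := Metric.isBounded_iff.1 (isCompact_univ (X := K)).isBounded
  have hD0 : 0 ≤ D := dist_nonneg.trans (hD (Set.mem_univ x) (Set.mem_univ x))
  obtain ⟨m, hm⟩ := exists_pow_lt_of_lt_one (div_pos hε (by linarith : 0 < D + 1))
    (by norm_num : (3 / 4 : ℝ) < 1)
  obtain ⟨w, z, hw, rfl⟩ := exists_cellMap_eq m x
  refine ⟨_, ⟨w, rfl⟩, (dist_cellMap_le w z q₁).trans_lt ?_⟩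
  rw [lt_div_iff₀ (by linarith)] at hm
  rw [hw]
  refine lt_of_le_of_lt (mul_le_mul_of_nonneg_left ?_ (by positivity)) hm
  linarith [hD (Set.mem_univ z) (Set.mem_univ q₁)]

theorem EnergyLE.sq_sub_q₁_le {u : C(K, ℝ)} {e : ℝ} (hu : EnergyLE u e) (x : K) :
    (u x - u q₁) ^ 2 ≤ e := by
  have hcl : IsClosed {x | (u x - u q₁) ^ 2 ≤ e} :=
    isClosed_le (by fun_prop) continuous_const
  refine closure_minimal ?_ hcl (dense_vertices x)
  rintro _ ⟨w, rfl⟩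
  exact (sq_sub_q₁_le_discreteEnergy w 0 u).trans (hu _)

theorem EnergyLE.sq_sub_le_four {u : C(K, ℝ)} {e : ℝ} (hu : EnergyLE u e) (x y : K) :
    (u x - u y) ^ 2 ≤ 4 * e := by
  nlinarith [hu.sq_sub_q₁_le x, hu.sq_sub_q₁_le y, sq_nonneg (u x - u q₁ + (u y - u q₁))]

/-- The resistance metric as a real number. -/
noncomputable def resDist (x y : K) : ℝ := (R x y).toReal

theorem R_le_of_sq_sub_le {x y : K} {a : ℝ} (ha : 0 ≤ a)
    (h : ∀ (u : C(K, ℝ)) (e : ℝ), EnergyLE u e → (u x - u y) ^ 2 ≤ a * e) :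
    R x y ≤ ENNReal.ofReal a :=
  resistance_le ha fun u e hx hy hu => by
    have := h u e hu
    rw [hx x rfl, hy y rfl] at this
    simpa using this

theorem R_ne_top (x y : K) : R x y ≠ ∞ :=
  ne_top_of_le_ne_top ENNReal.ofReal_ne_top
    (R_le_of_sq_sub_le (by norm_num) fun _ _ hu => hu.sq_sub_le_four x y)

theorem resDist_nonneg (x y : K) : 0 ≤ resDist x y := ENNReal.toReal_nonneg

theorem resDist_le {x y : K} {a : ℝ} (ha : 0 ≤ a)
    (h : ∀ (u : C(K, ℝ)) (e : ℝ), EnergyLE u e → (u x - u y) ^ 2 ≤ a * e) : resDist x y ≤ a :=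
  ENNReal.toReal_le_of_le_ofReal ha (R_le_of_sq_sub_le ha h)

/-- Continuous functions of finite energy are `1/2`-Hölder with respect to the resistance metric. -/
theorem EnergyLE.sq_sub_le {u : C(K, ℝ)} {e : ℝ} (hu : EnergyLE u e) (x y : K) :
    (u x - u y) ^ 2 ≤ resDist x y * e := by
  by_cases h : u y - u x = 0
  · rw [sub_eq_zero.1 h, sub_self, zero_pow two_ne_zero]
    exact mul_nonneg (resDist_nonneg x y) hu.nonneg
  have hp : 0 < (u y - u x) ^ 2 := by positivity
  have he : 0 < e := by nlinarith [hu.sq_sub_le_four x y]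
  let v : C(K, ℝ) := ⟨fun z => (u y - u x)⁻¹ * u z + -((u y - u x)⁻¹ * u x), by fun_prop⟩
  have hv : EnergyLE v ((u y - u x)⁻¹ ^ 2 * e) := hu.affine _ _
  have hR : ENNReal.ofReal ((u y - u x)⁻¹ ^ 2 * e)⁻¹ ≤ R x y := by
    refine le_resistance (u := v) (by positivity) ?_ ?_ hv
    · rintro _ rfl
      simp [v]
    · rintro _ rfl
      simp only [v, ContinuousMap.coe_mk]
      field_simp
      ring
  rw [ENNReal.ofReal_le_iff_le_toReal (R_ne_top x y)] at hR
  have : ((u y - u x)⁻¹ ^ 2 * e)⁻¹ = (u x - u y) ^ 2 / e := by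
    field_simp
    ring
  rw [this, div_le_iff₀ he] at hR
  exact hR

theorem resDist_comm (x y : K) : resDist x y = resDist y x := by
  have : ∀ x y, resDist x y ≤ resDist y x := fun x y =>
    resDist_le (resDist_nonneg _ _) fun u e hu => by
      rw [← neg_sub, neg_sq]
      exact hu.sq_sub_le y x
  exact le_antisymm (this _ _) (this _ _)

@[simp] theorem resDist_self (x : K) : resDist x x = 0 :=
  le_antisymm (resDist_le le_rfl fun u e _ => by simp) (resDist_nonneg _ _)

/-- The energy of `u` dominates the sum of the energies of `u ⊓ t` and `u ⊔ t`; taking for `t` the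
value of `u` at the intermediate point gives the triangle inequality. -/
theorem resDist_triangle (x z y : K) : resDist x y ≤ resDist x z + resDist z y := by
  have ha := resDist_nonneg x z
  have hb := resDist_nonneg z y
  refine resDist_le (add_nonneg ha hb) fun u e hu => ?_
  obtain ⟨a, b, h1, h2, hab⟩ := hu.exists_split (u := fun p => min (u p) (u z))
    (v := fun p => max (u p) (u z)) fun p q => sq_min_add_sq_max_le _ _ _
  let u₁ : C(K, ℝ) := ⟨fun p => min (u p) (u z), by fun_prop⟩
  let u₂ : C(K, ℝ) := ⟨fun p => max (u p) (u z), by fun_prop⟩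
  have h1 : EnergyLE u₁ a := h1
  have h2 : EnergyLE u₂ b := h2
  have ha0 := h1.nonneg
  have hb0 := h2.nonneg
  -- Cauchy–Schwarz in the form `(p + q)² ≤ (s + t)(a + b)` for `p² ≤ s a` and `q² ≤ t b`
  have cs : ∀ s t p q c d : ℝ, 0 ≤ s → 0 ≤ t → 0 ≤ c → 0 ≤ d → p ^ 2 ≤ s * c → q ^ 2 ≤ t * d →
      c + d ≤ e → (p + q) ^ 2 ≤ (s + t) * e := by
    intro s t p q c d hs ht hc hd hp hq he
    have h3 : (p * q) ^ 2 ≤ (s * d) * (t * c) := by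
      rw [mul_pow]
      calc p ^ 2 * q ^ 2 ≤ (s * c) * (t * d) :=
            mul_le_mul hp hq (sq_nonneg _) (mul_nonneg hs hc)
        _ = _ := by ring
    have h4 : 2 * (p * q) ≤ s * d + t * c := by
      have h5 : 0 ≤ s * d + t * c := by positivity
      refine le_of_sq_le_sq ?_ h5
      nlinarith [sq_nonneg (s * d - t * c)]
    nlinarith
  rcases le_total (u x) (u z) with hxz | hxz <;> rcases le_total (u z) (u y) with hzy | hzy
  · have e1 := h1.sq_sub_le x z
    have e2 := h2.sq_sub_le z y
    simp only [u₁, u₂, ContinuousMap.coe_mk, min_self, max_self, min_eq_left hxz,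
      max_eq_left hzy] at e1 e2
    have := cs _ _ _ _ _ _ ha hb ha0 hb0 e1 e2 hab
    simpa using this
  · rcases le_total (u x) (u y) with h | h
    · nlinarith [hu.sq_sub_le x z, mul_nonneg hb hu.nonneg]
    · nlinarith [hu.sq_sub_le z y, mul_nonneg ha hu.nonneg]
  · rcases le_total (u x) (u y) with h | h
    · nlinarith [hu.sq_sub_le z y, mul_nonneg ha hu.nonneg]
    · nlinarith [hu.sq_sub_le x z, mul_nonneg hb hu.nonneg]
  · have e1 := h2.sq_sub_le x z
    have e2 := h1.sq_sub_le z y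
    simp only [u₁, u₂, ContinuousMap.coe_mk, min_self, max_self, max_eq_left hxz,
      min_eq_left hzy] at e1 e2
    have := cs _ _ _ _ _ _ ha hb hb0 ha0 e1 e2 (by linarith)
    simpa using this

theorem resDist_q₁_le (x : K) : resDist x q₁ ≤ 1 :=
  resDist_le zero_le_one fun u e hu => by simpa using hu.sq_sub_q₁_le x

theorem resDist_le_two (x y : K) : resDist x y ≤ 2 := by
  linarith [resDist_triangle x q₁ y, resDist_q₁_le x, resDist_q₁_le y, resDist_comm q₁ y]

theorem resDist_q₂_q₁ : resDist q₂ q₁ = 1 := by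
  refine le_antisymm (resDist_q₁_le _) ?_
  obtain ⟨u, h1, h2, h3, hu⟩ := exists_harmonic_left
  simpa [h1, h2] using hu.sq_sub_le q₂ q₁

theorem resDist_q₃_q₁ : resDist q₃ q₁ = 1 := by
  refine le_antisymm (resDist_q₁_le _) ?_
  obtain ⟨u, h1, h2, h3, hu⟩ := exists_harmonic_right
  simpa [h1, h3] using hu.sq_sub_le q₃ q₁

/-! ### Scaling and cut points of the resistance metric -/

/-- The map `F_i` as a continuous map. -/
noncomputable def FC (i : Fin 4) : C(K, K) := ⟨F i, F_continuous i⟩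

@[simp] theorem FC_apply (i : Fin 4) (x : K) : FC i x = F i x := rfl

/-- A function on one cell extends to `K` by constants, without additional energy. -/
theorem exists_extend (i : Fin 4) {v : C(K, ℝ)} {e : ℝ} (hv : EnergyLE v e) :
    ∃ u : C(K, ℝ), (∀ z, u (F i z) = v z) ∧ EnergyLE u (2 * e) := by
  have hc : ∀ c, EnergyLE (ContinuousMap.const K c) 0 := EnergyLE.const
  let c : K → C(K, ℝ) := fun x => ContinuousMap.const K (v x)
  have key : ∀ g : Fin 4 → C(K, ℝ), Compatible g → g i = v →
      (∀ j, EnergyLE (g j) (if j = i then e else 0)) →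
      ∃ u : C(K, ℝ), (∀ z, u (F i z) = v z) ∧ EnergyLE u (2 * e) := by
    intro g hg hgi hge
    obtain ⟨u, hu, hue⟩ := exists_glue_energyLE hg hge
    refine ⟨u, fun z => by rw [hu, hgi], hue.mono (le_of_eq ?_)⟩
    rw [← Fin.sum_univ_four (fun j => if j = i then e else 0)]
    simp
  fin_cases i
  · refine key ![v, c q₁, c q₂, c q₁] ⟨rfl, rfl, rfl⟩ rfl fun j => ?_
    fin_cases j
    exacts [hv, hc _, hc _, hc _]
  · refine key ![c q₁, v, c q₁, c q₃] ⟨rfl, rfl, rfl⟩ rfl fun j => ?_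
    fin_cases j
    exacts [hc _, hv, hc _, hc _]
  · refine key ![c q₁, c q₁, v, c q₁] ⟨rfl, rfl, rfl⟩ rfl fun j => ?_
    fin_cases j
    exacts [hc _, hc _, hv, hc _]
  · refine key ![c q₁, c q₁, c q₁, v] ⟨rfl, rfl, rfl⟩ rfl fun j => ?_
    fin_cases j
    exacts [hc _, hc _, hc _, hv]

theorem resDist_F (i : Fin 4) (x y : K) : resDist (F i x) (F i y) = resDist x y / 2 := by
  have h0 := resDist_nonneg x y
  apply le_antisymm
  · refine resDist_le (by positivity) fun u e hu => ?_
    have := EnergyLE.sq_sub_le (u := u.comp (FC i)) (hu.comp_F i) x y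
    simp only [ContinuousMap.comp_apply, FC_apply] at this
    linarith
  · have h1 := resDist_nonneg (F i x) (F i y)
    have : resDist x y ≤ 2 * resDist (F i x) (F i y) := by
      refine resDist_le (by positivity) fun v e hv => ?_
      obtain ⟨u, hu, hue⟩ := exists_extend i hv
      have := hue.sq_sub_le (F i x) (F i y)
      rw [hu, hu] at this
      linarith
    linarith

theorem resDist_cellMap (w : List (Fin 4)) (x y : K) :
    resDist (cellMap w x) (cellMap w y) = (1 / 2) ^ w.length * resDist x y := by
  induction w with
  | nil => simp [cellMap]
  | cons i w ih =>
    rw [cellMap, cellMap, resDist_F, ih, List.length_cons, pow_succ]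
    ring

/-- The point `p` separates the cells with index in `S` from the other ones: two functions that
agree at `p` may be used on the two sides of `p`. -/
def IsCut (p : K) (S : Finset (Fin 4)) : Prop :=
  ∀ u v : C(K, ℝ), u p = v p → Compatible fun i => if i ∈ S then u.comp (FC i) else v.comp (FC i)

theorem isCut_q₁ : IsCut q₁ {0, 2} := fun u v h =>
  ⟨by simpa using h, by simp [F_glue_left], by simp [F_glue_right]⟩

theorem isCut_left : IsCut (F 2 q₁) {2} := fun u v h =>
  ⟨by simp, by simpa [F_glue_left] using h.symm, by simp [F_glue_right]⟩

theorem isCut_right : IsCut (F 3 q₁) {3} := fun u v h =>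
  ⟨by simp, by simp [F_glue_left], by simpa [F_glue_right] using h.symm⟩

theorem IsCut.exists_mix {p : K} {S : Finset (Fin 4)} (hp : IsCut p S) {u v : C(K, ℝ)} {a b : ℝ}
    (h : u p = v p) (hu : EnergyLE u a) (hv : EnergyLE v b) :
    ∃ g : C(K, ℝ), (∀ i ∈ S, ∀ z, g (F i z) = u (F i z)) ∧ (∀ i ∉ S, ∀ z, g (F i z) = v (F i z)) ∧
      EnergyLE g (a + b) := by
  obtain ⟨g, hg⟩ := exists_glue (hp u v h)
  have h1 : ∀ i ∈ S, ∀ z, g (F i z) = u (F i z) := fun i hi z => by rw [hg, if_pos hi]; rfl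
  have h2 : ∀ i ∉ S, ∀ z, g (F i z) = v (F i z) := fun i hi z => by rw [hg, if_neg hi]; rfl
  have key : ∀ n, discreteEnergy (n + 1) g ≤ a + b := fun n => by
    refine le_trans ?_ (add_le_add (hu (n + 1)) (hv (n + 1)))
    rw [discreteEnergy_succ_sum, discreteEnergy_succ_sum, discreteEnergy_succ_sum, ← mul_add,
      ← Finset.sum_add_distrib]
    refine mul_le_mul_of_nonneg_left (Finset.sum_le_sum fun i _ => ?_) zero_le_two
    by_cases hi : i ∈ S
    · have : g ∘ F i = u ∘ F i := funext (h1 i hi)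
      rw [this]
      exact le_add_of_nonneg_right (discreteEnergy_nonneg _ _)
    · have : g ∘ F i = v ∘ F i := funext (h2 i hi)
      rw [this]
      exact le_add_of_nonneg_left (discreteEnergy_nonneg _ _)
  exact ⟨g, h1, h2, fun n => (discreteEnergy_le_succ n g).trans (key n)⟩

theorem resDist_le_of_pos {x y : K} {a : ℝ} (ha : 0 ≤ a)
    (h : ∀ (u : C(K, ℝ)) (e : ℝ), 0 < e → EnergyLE u e → (u x - u y) ^ 2 / e ≤ a) :
    resDist x y ≤ a := by
  refine resDist_le ha fun u e hu => ?_
  rcases hu.nonneg.eq_or_lt with rfl | he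
  · simpa using hu.sq_sub_le x y
  · exact (div_le_iff₀ he).1 (h u e he hu)

/-- Resistances in series: resistances add up at a cut point. -/
theorem IsCut.resDist_eq {p : K} {S : Finset (Fin 4)} (hp : IsCut p S) {i j : Fin 4} (hi : i ∈ S)
    (hj : j ∉ S) (x y : K) :
    resDist (F i x) (F j y) = resDist (F i x) p + resDist p (F j y) := by
  refine le_antisymm (resDist_triangle _ _ _) ?_
  set c := resDist (F i x) (F j y)
  have key : ∀ (u v : C(K, ℝ)) (d e : ℝ), 0 < d → 0 < e → EnergyLE u d → EnergyLE v e →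
      (u (F i x) - u p) ^ 2 / d + (v p - v (F j y)) ^ 2 / e ≤ c := by
    intro u v d e hd he hu hv
    set a := u (F i x) - u p
    set b := v p - v (F j y)
    -- rescaled so that on each side of `p` the energy bound equals the increment
    let u' : C(K, ℝ) := ⟨fun z => a / d * u z + -(a / d * u p), by fun_prop⟩
    let v' : C(K, ℝ) := ⟨fun z => b / e * v z + -(b / e * v p), by fun_prop⟩
    have hu' : EnergyLE u' ((a / d) ^ 2 * d) := hu.affine _ _
    have hv' : EnergyLE v' ((b / e) ^ 2 * e) := hv.affine _ _
    obtain ⟨g, hg1, hg2, hg⟩ := hp.exists_mix (by simp [u', v']) hu' hv'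
    have h1 := hg.sq_sub_le (F i x) (F j y)
    have h2 : g (F i x) - g (F j y) = a ^ 2 / d + b ^ 2 / e := by
      rw [hg1 i hi, hg2 j hj]
      simp only [u', v', ContinuousMap.coe_mk, a, b]
      ring
    have h3 : (a / d) ^ 2 * d + (b / e) ^ 2 * e = a ^ 2 / d + b ^ 2 / e := by
      field_simp
    rw [h2, h3, pow_two] at h1
    have h4 : 0 ≤ a ^ 2 / d + b ^ 2 / e := by positivity
    rcases h4.eq_or_lt with h | h
    · rw [← h]
      exact resDist_nonneg _ _
    · exact le_of_mul_le_mul_right h1 h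
  have hc : ∀ c, EnergyLE (ContinuousMap.const K c) 1 := fun c =>
    (EnergyLE.const c).mono zero_le_one
  have h1 : ∀ (u : C(K, ℝ)) (d : ℝ), 0 < d → EnergyLE u d →
      resDist p (F j y) ≤ c - (u (F i x) - u p) ^ 2 / d := fun u d hd hu => by
    refine resDist_le_of_pos ?_ fun v e he hv => ?_
    · have := key u (ContinuousMap.const K 0) d 1 hd one_pos hu (hc 0)
      simp only [ContinuousMap.const_apply, sub_self] at this
      linarith
    · linarith [key u v d e hd he hu hv]
  have h2 : resDist (F i x) p ≤ c - resDist p (F j y) := by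
    refine resDist_le_of_pos ?_ fun u d hd hu => by linarith [h1 u d hd hu]
    have := h1 (ContinuousMap.const K 0) 1 one_pos (hc 0)
    simp only [ContinuousMap.const_apply, sub_self] at this
    linarith
  linarith

theorem resDist_q₁_of_mem {i j : Fin 4} (hi : i = 0 ∨ i = 2) (hj : j = 1 ∨ j = 3) (x y : K) :
    resDist (F i x) (F j y) = resDist (F i x) q₁ + resDist (F j y) q₁ := by
  rw [resDist_comm (F j y) q₁]
  refine isCut_q₁.resDist_eq (by simpa using hi) ?_ x y
  rcases hj with rfl | rfl <;> decide

theorem resDist_F_two_left {j : Fin 4} (hj : j ≠ 2) (x y : K) :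
    resDist (F 2 x) (F j y) = resDist x q₁ / 2 + resDist (F j y) (F 2 q₁) := by
  rw [resDist_comm (F j y), ← resDist_F 2 x]
  exact isCut_left.resDist_eq (by simp) (by simpa using hj) x y

theorem resDist_F_three_left {j : Fin 4} (hj : j ≠ 3) (x y : K) :
    resDist (F 3 x) (F j y) = resDist x q₁ / 2 + resDist (F j y) (F 3 q₁) := by
  rw [resDist_comm (F j y), ← resDist_F 3 x]
  exact isCut_right.resDist_eq (by simp) (by simpa using hj) x y

theorem resDist_F_zero_q₁ (z : K) : resDist (F 0 z) q₁ = resDist z q₁ / 2 := by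
  simpa using resDist_F 0 z q₁

theorem resDist_F_one_q₁ (z : K) : resDist (F 1 z) q₁ = resDist z q₁ / 2 := by
  simpa using resDist_F 1 z q₁

theorem resDist_F_two_q₁ (z : K) : resDist (F 2 z) q₁ = 1 / 2 + resDist z q₁ / 2 := by
  have h := resDist_F_two_left (j := 0) (by decide) z q₁
  rw [← F_glue_left, resDist_F, resDist_comm q₁ q₂, resDist_q₂_q₁, F_zero_q₁] at h
  linarith

theorem resDist_F_three_q₁ (z : K) : resDist (F 3 z) q₁ = 1 / 2 + resDist z q₁ / 2 := by
  have h := resDist_F_three_left (j := 1) (by decide) z q₁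
  rw [← F_glue_right, resDist_F, resDist_comm q₁ q₃, resDist_q₃_q₁, F_one_q₁] at h
  linarith

theorem resDist_F_zero_q₂ (z : K) : resDist (F 0 z) q₂ = 1 / 2 + resDist z q₂ / 2 := by
  have h := resDist_F_two_left (j := 0) (by decide) q₂ z
  rwa [← F_glue_left, resDist_F, resDist_q₂_q₁, F_two_q₂, resDist_comm] at h

theorem resDist_F_one_q₂ (z : K) : resDist (F 1 z) q₂ = 1 + resDist z q₁ / 2 := by
  have h := resDist_q₁_of_mem (i := 2) (j := 1) (by simp) (by simp) q₂ z
  rwa [F_two_q₂, resDist_q₂_q₁, resDist_F_one_q₁, resDist_comm] at h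

theorem resDist_F_two_q₂ (z : K) : resDist (F 2 z) q₂ = resDist z q₂ / 2 := by
  simpa using resDist_F 2 z q₂

theorem resDist_F_three_q₂ (z : K) : resDist (F 3 z) q₂ = 3 / 2 + resDist z q₁ / 2 := by
  have h := resDist_q₁_of_mem (i := 2) (j := 3) (by simp) (by simp) q₂ z
  rw [F_two_q₂, resDist_q₂_q₁, resDist_F_three_q₁, resDist_comm] at h
  linarith

theorem resDist_F_one_q₃ (z : K) : resDist (F 1 z) q₃ = 1 / 2 + resDist z q₃ / 2 := by
  have h := resDist_F_three_left (j := 1) (by decide) q₃ z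
  rwa [← F_glue_right, resDist_F, resDist_q₃_q₁, F_three_q₃, resDist_comm] at h

theorem resDist_F_zero_q₃ (z : K) : resDist (F 0 z) q₃ = 1 + resDist z q₁ / 2 := by
  have h := resDist_q₁_of_mem (i := 0) (j := 3) (by simp) (by simp) z q₃
  rw [F_three_q₃, resDist_q₃_q₁, resDist_F_zero_q₁] at h
  linarith

theorem resDist_F_three_q₃ (z : K) : resDist (F 3 z) q₃ = resDist z q₃ / 2 := by
  simpa using resDist_F 3 z q₃

theorem resDist_F_two_q₃ (z : K) : resDist (F 2 z) q₃ = 3 / 2 + resDist z q₁ / 2 := by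
  have h := resDist_q₁_of_mem (i := 2) (j := 3) (by simp) (by simp) z q₃
  rw [F_three_q₃, resDist_q₃_q₁, resDist_F_two_q₁] at h
  linarith

theorem resDist_F_zero_q₀ (z : K) : resDist (F 0 z) q₀ = resDist z q₂ / 2 := resDist_F 0 z q₂

theorem resDist_F_two_q₀ (z : K) : resDist (F 2 z) q₀ = resDist z q₁ / 2 := by
  rw [q₀_eq, resDist_F]

theorem resDist_F_one_q₀ (z : K) : resDist (F 1 z) q₀ = 1 / 2 + resDist z q₁ / 2 := by
  have h := resDist_q₁_of_mem (i := 0) (j := 1) (by simp) (by simp) q₂ z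
  rwa [resDist_F_zero_q₁, resDist_F_one_q₁, resDist_q₂_q₁, resDist_comm] at h

theorem resDist_F_three_q₀ (z : K) : resDist (F 3 z) q₀ = 1 + resDist z q₁ / 2 := by
  have h := resDist_q₁_of_mem (i := 0) (j := 3) (by simp) (by simp) q₂ z
  rw [resDist_F_zero_q₁, resDist_F_three_q₁, resDist_q₂_q₁, resDist_comm] at h
  exact h.trans (by ring)

theorem resDist_q₃_q₂ : resDist q₃ q₂ = 2 := by
  have := resDist_F_three_q₂ q₃
  rw [F_three_q₃, resDist_q₃_q₁] at this
  linarith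

/-- Seen from a corner, the distance on the cell `F_i(K)` is the distance from one of the corners
of that cell, up to an additive multiple of `1/2`. -/
theorem exists_resDist_F_Q (i : Fin 4) (b : Fin 3) : ∃ (k : ℕ) (b' : Fin 3),
    (∀ z, resDist (F i z) (Q b) = k / 2 + resDist z (Q b') / 2) ∧
      (k = 0 → F i (Q b') = Q b) := by
  fin_cases b <;> fin_cases i
  · exact ⟨0, 0, fun z => by simp [resDist_F_zero_q₁], by simp⟩
  · exact ⟨0, 0, fun z => by simp [resDist_F_one_q₁], by simp⟩
  · exact ⟨1, 0, fun z => by simp [resDist_F_two_q₁], by simp⟩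
  · exact ⟨1, 0, fun z => by simp [resDist_F_three_q₁], by simp⟩
  · exact ⟨1, 1, fun z => by simp [resDist_F_zero_q₂], by simp⟩
  · exact ⟨2, 0, fun z => by simp [resDist_F_one_q₂], by simp⟩
  · exact ⟨0, 1, fun z => by simp [resDist_F_two_q₂], by simp⟩
  · exact ⟨3, 0, fun z => by simp [resDist_F_three_q₂], by simp⟩
  · exact ⟨2, 0, fun z => by simp [resDist_F_zero_q₃], by simp⟩
  · exact ⟨1, 2, fun z => by simp [resDist_F_one_q₃], by simp⟩
  · exact ⟨3, 0, fun z => by simp [resDist_F_two_q₃], by simp⟩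
  · exact ⟨0, 2, fun z => by simp [resDist_F_three_q₃], by simp⟩

theorem exists_resDist_F_q₀ (i : Fin 4) : ∃ (k : ℕ) (b' : Fin 3),
    ∀ z, resDist (F i z) q₀ = k / 2 + resDist z (Q b') / 2 := by
  fin_cases i
  · exact ⟨0, 1, fun z => by simp [resDist_F_zero_q₀]⟩
  · exact ⟨1, 0, fun z => by simp [resDist_F_one_q₀]⟩
  · exact ⟨0, 0, fun z => by simp [resDist_F_two_q₀]⟩
  · exact ⟨2, 0, fun z => by simp [resDist_F_three_q₀]⟩

/-! ### Distances between vertices -/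

theorem exists_resDist_Q_Q (j b : Fin 3) : ∃ k : ℕ, resDist (Q j) (Q b) = k := by
  fin_cases j <;> fin_cases b <;>
    simp [resDist_q₂_q₁, resDist_q₃_q₁, resDist_q₃_q₂, resDist_comm q₁ q₂, resDist_comm q₁ q₃,
      resDist_comm q₂ q₃]
  exacts [⟨0, by simp⟩, ⟨1, by simp⟩, ⟨1, by simp⟩, ⟨1, by simp⟩, ⟨0, by simp⟩, ⟨2, by simp⟩,
    ⟨1, by simp⟩, ⟨2, by simp⟩, ⟨0, by simp⟩]

theorem Q_eq_of_resDist_eq_zero {j b : Fin 3} (h : resDist (Q j) (Q b) = 0) : Q j = Q b := by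
  fin_cases j <;> fin_cases b <;>
    simp [resDist_q₂_q₁, resDist_q₃_q₁, resDist_q₃_q₂, resDist_comm q₁ q₂, resDist_comm q₁ q₃,
      resDist_comm q₂ q₃] at h ⊢

theorem exists_resDist_vertex_Q (w : List (Fin 4)) (j b : Fin 3) :
    ∃ k : ℕ, resDist (cellMap w (Q j)) (Q b) = k * (1 / 2) ^ w.length := by
  induction w generalizing b with
  | nil => simpa [cellMap] using exists_resDist_Q_Q j b
  | cons i w ih =>
    obtain ⟨k, b', h, -⟩ := exists_resDist_F_Q i b
    obtain ⟨l, hl⟩ := ih b'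
    refine ⟨k * 2 ^ w.length + l, ?_⟩
    rw [cellMap, h, hl, List.length_cons]
    push_cast
    rw [pow_succ, add_mul, mul_assoc, ← mul_assoc (2 ^ _), ← mul_pow]
    norm_num
    ring

theorem exists_resDist_vertex_q₀ {w : List (Fin 4)} (hw : w ≠ []) (j : Fin 3) :
    ∃ k : ℕ, resDist (cellMap w (Q j)) q₀ = k * (1 / 2) ^ w.length := by
  cases w with
  | nil => exact absurd rfl hw
  | cons i w =>
    obtain ⟨k, b', h⟩ := exists_resDist_F_q₀ i
    obtain ⟨l, hl⟩ := exists_resDist_vertex_Q w j b'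
    refine ⟨k * 2 ^ w.length + l, ?_⟩
    rw [cellMap, h, hl, List.length_cons]
    push_cast
    rw [pow_succ, add_mul, mul_assoc, ← mul_assoc (2 ^ _), ← mul_pow]
    norm_num
    ring

theorem vertex_eq_of_resDist_eq_zero {w : List (Fin 4)} {j b : Fin 3}
    (h : resDist (cellMap w (Q j)) (Q b) = 0) : cellMap w (Q j) = Q b := by
  induction w generalizing b with
  | nil => exact Q_eq_of_resDist_eq_zero h
  | cons i w ih =>
    obtain ⟨k, b', hk, hb⟩ := exists_resDist_F_Q i b
    rw [cellMap, hk] at h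
    have h0 := resDist_nonneg (cellMap w (Q j)) (Q b')
    have hk0 : (0 : ℝ) ≤ k := k.cast_nonneg
    have hz : (k : ℝ) = 0 := by linarith
    rw [cellMap, ih (b := b') (by linarith), hb (by exact_mod_cast hz)]

theorem half_le_resDist_Q_q₀ (j : Fin 3) : 1 / 2 ≤ resDist (Q j) q₀ := by
  have h0 := resDist_F_zero_q₀ q₁
  have h2 := resDist_F_two_q₀ q₂
  have h3 := resDist_F_three_q₀ q₃
  rw [F_zero_q₁, resDist_comm q₁ q₂, resDist_q₂_q₁] at h0
  rw [F_two_q₂, resDist_q₂_q₁] at h2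
  rw [F_three_q₃, resDist_q₃_q₁] at h3
  fin_cases j
  · exact h0.ge
  · exact h2.ge
  · exact (by linarith : 1 / 2 ≤ resDist q₃ q₀)

theorem exists_resDist_le_Q (x : K) (b : Fin 3) :
    ∃ j, resDist x (Q b) ≤ resDist (Q j) (Q b) := by
  fin_cases b
  · exact ⟨1, (resDist_q₁_le x).trans resDist_q₂_q₁.ge⟩
  · exact ⟨2, (resDist_le_two x _).trans resDist_q₃_q₂.ge⟩
  · exact ⟨1, (resDist_le_two x _).trans (resDist_comm q₂ q₃ ▸ resDist_q₃_q₂).ge⟩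

theorem exists_resDist_cellMap_le_Q (w : List (Fin 4)) (x : K) (b : Fin 3) :
    ∃ j, resDist (cellMap w x) (Q b) ≤ resDist (cellMap w (Q j)) (Q b) := by
  induction w generalizing b with
  | nil => exact exists_resDist_le_Q x b
  | cons i w ih =>
    obtain ⟨k, b', h, -⟩ := exists_resDist_F_Q i b
    obtain ⟨j, hj⟩ := ih b'
    refine ⟨j, ?_⟩
    rw [cellMap, cellMap, h, h]
    linarith

/-- On a cell, the distance from `q₀` is maximal at a corner of the cell. -/
theorem exists_resDist_cellMap_le_q₀ {w : List (Fin 4)} (hw : w ≠ []) (x : K) :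
    ∃ j, resDist (cellMap w x) q₀ ≤ resDist (cellMap w (Q j)) q₀ := by
  cases w with
  | nil => exact absurd rfl hw
  | cons i w =>
    obtain ⟨k, b', h⟩ := exists_resDist_F_q₀ i
    obtain ⟨j, hj⟩ := exists_resDist_cellMap_le_Q w x b'
    refine ⟨j, ?_⟩
    rw [cellMap, cellMap, h, h]
    linarith

/-! ### Upper bounds -/

theorem mem_ball_iff {n : ℕ} {x : K} : x ∈ ball n ↔ resDist x q₀ < (1 / 2) ^ n :=
  ENNReal.lt_ofReal_iff_toReal_lt (R_ne_top x q₀)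

theorem mem_compl_ball_iff {n : ℕ} {x : K} : x ∈ (ball n)ᶜ ↔ (1 / 2) ^ n ≤ resDist x q₀ := by
  rw [Set.mem_compl_iff, mem_ball_iff, not_lt]

/-- At `q₁` there are `2 ^ (k + 1)` arms of length `2 ^ (-k)`, which act as resistors in
parallel. -/
theorem le_discreteEnergy_of_eq_one_q₁ (k : ℕ) {u : K → ℝ}
    (h : ∀ z, (1 / 2) ^ k ≤ resDist z q₁ → u z = 1) :
    2 * 4 ^ k * (1 - u q₁) ^ 2 ≤ discreteEnergy k u := by
  induction k generalizing u with
  | zero =>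
    rw [discreteEnergy, h q₂ (by simp [resDist_q₂_q₁]), h q₃ (by simp [resDist_q₃_q₁])]
    exact le_of_eq (by ring)
  | succ k ih =>
    have h0 := ih (u := u ∘ F 0) fun z hz => h _ (by
      rw [resDist_F_zero_q₁, pow_succ]
      linarith)
    have h1 := ih (u := u ∘ F 1) fun z hz => h _ (by
      rw [resDist_F_one_q₁, pow_succ]
      linarith)
    simp only [Function.comp_apply, F_zero_q₁, F_one_q₁] at h0 h1
    rw [discreteEnergy_succ, pow_succ]
    linarith [discreteEnergy_nonneg k (u ∘ F 2), discreteEnergy_nonneg k (u ∘ F 3)]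

theorem EnergyLE.sq_le_of_eq_one_compl_ball {n : ℕ} (hn : 1 ≤ n) {u : K → ℝ} {e : ℝ}
    (hu : EnergyLE u e) (h : ∀ z ∈ (ball n)ᶜ, u z = 1) :
    (1 - u q₀) ^ 2 ≤ (1 / 2) ^ (2 * n) * e := by
  obtain ⟨k, rfl⟩ := Nat.exists_eq_add_of_le' hn
  have h1 := le_discreteEnergy_of_eq_one_q₁ k (u := u ∘ F 2) fun z hz => h _ (by
    rw [mem_compl_ball_iff, resDist_F_two_q₀, pow_succ]
    linarith)
  rw [Function.comp_apply, ← q₀_eq] at h1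
  have h2 := (discreteEnergy_comp_F_le k 2 u).trans (hu (k + 1))
  have h3 : (1 / 2 : ℝ) ^ (2 * (k + 1)) * 4 ^ (k + 1) = 1 := by
    rw [pow_mul, ← mul_pow]
    norm_num
  calc (1 - u q₀) ^ 2 = (1 / 2 : ℝ) ^ (2 * (k + 1)) * 4 ^ (k + 1) * (1 - u q₀) ^ 2 := by
        rw [h3, one_mul]
    _ = (1 / 2 : ℝ) ^ (2 * (k + 1)) * (2 * (2 * 4 ^ k * (1 - u q₀) ^ 2)) := by
        rw [pow_succ (4 : ℝ)]
        ring
    _ ≤ _ := mul_le_mul_of_nonneg_left (by linarith) (by positivity)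

theorem resistance_le_add {n : ℕ} (hn : 1 ≤ n) (x : K) :
    resistance {x} (ball n)ᶜ ≤
      ENNReal.ofReal (2 * (resDist x q₀ + (1 / 2) ^ (2 * n))) := by
  have h0 := resDist_nonneg x q₀
  refine resistance_le (by positivity) fun u e hx hB hu => ?_
  have h1 := hu.sq_sub_le x q₀
  have h2 := hu.sq_le_of_eq_one_compl_ball hn hB
  rw [hx x rfl] at h1
  nlinarith [sq_nonneg (2 * u q₀ - 1)]

theorem dyadic_gap {k l n : ℕ} (hnl : n ≤ l) (h : (k : ℝ) * (1 / 2) ^ l < (1 / 2) ^ n) :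
    ((k : ℝ) + 1) * (1 / 2) ^ l ≤ (1 / 2) ^ n := by
  obtain ⟨d, rfl⟩ := Nat.exists_eq_add_of_le hnl
  have e : (1 / 2 : ℝ) ^ n = 2 ^ d * (1 / 2) ^ (n + d) := by
    rw [pow_add, mul_left_comm, ← mul_pow]
    norm_num
  rw [e] at h ⊢
  have h1 : (k : ℝ) < 2 ^ d := lt_of_mul_lt_mul_right h (by positivity)
  have h2 : k + 1 ≤ 2 ^ d := by exact_mod_cast h1
  exact mul_le_mul_of_nonneg_right (by exact_mod_cast h2) (by positivity)

/-- A cell whose size is comparable to the distance from `x` to the sphere of radius `2 ^ (-n)`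
has a corner outside `B_n`, because the distances of its corners from `q₀` are integer multiples
of its size. -/
theorem resistance_le_sub {n : ℕ} (hn : 1 ≤ n) {x : K} (hx : x ∈ ball n) :
    resistance {x} (ball n)ᶜ ≤ ENNReal.ofReal (4 * ((1 / 2) ^ n - resDist x q₀)) := by
  have hr := mem_ball_iff.1 hx
  rcases (resDist_nonneg x q₀).eq_or_lt with h0 | h0
  · refine (resistance_le_add hn x).trans (ENNReal.ofReal_le_ofReal ?_)
    rw [← h0]
    have : (1 / 2 : ℝ) ^ (2 * n) ≤ (1 / 2) ^ n :=
      pow_le_pow_of_le_one (by norm_num) (by norm_num) (by omega)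
    have : (0 : ℝ) < (1 / 2) ^ n := by positivity
    linarith
  set δ := (1 / 2) ^ n - resDist x q₀ with hδ
  have hn1 : (1 / 2 : ℝ) ^ n ≤ 1 / 2 := by
    simpa using pow_le_pow_of_le_one (by norm_num : (0 : ℝ) ≤ 1 / 2) (by norm_num) hn
  obtain ⟨m, hm1, hm2⟩ : ∃ m : ℕ, (1 / 2) ^ (m + 1) ≤ δ ∧ δ < (1 / 2) ^ m := by
    obtain ⟨m, h1, h2⟩ := exists_nat_pow_near_of_lt_one (x := δ) (y := 1 / 2) (by linarith)
      (by linarith) (by norm_num) (by norm_num)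
    rcases h2.lt_or_eq with h2 | h2
    · exact ⟨m, h1.le, h2⟩
    · obtain _ | m := m
      · linarith
      · exact ⟨m, h2.ge, by rw [h2, pow_succ]; linarith [show (0 : ℝ) < (1 / 2) ^ m by positivity]⟩
  have hnm : n ≤ m := by
    by_contra! h
    have : (1 / 2 : ℝ) ^ n ≤ (1 / 2) ^ (m + 1) :=
      pow_le_pow_of_le_one (by norm_num) (by norm_num) h
    linarith
  obtain ⟨w, z, hw, rfl⟩ := exists_cellMap_eq m x
  have hw0 : w ≠ [] := by
    rintro rfl
    simp at hw
    omega
  obtain ⟨j, hj⟩ := exists_resDist_cellMap_le_q₀ hw0 z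
  obtain ⟨k, hk⟩ := exists_resDist_vertex_q₀ hw0 j
  rw [hw] at hk
  have hp : cellMap w (Q j) ∈ (ball n)ᶜ := by
    rw [mem_compl_ball_iff, hk]
    by_contra! hlt
    have := dyadic_gap hnm hlt
    linarith
  refine resistance_le (by linarith) fun u e hxu hB hu => ?_
  have h1 := hu.sq_sub_le (cellMap w z) (cellMap w (Q j))
  rw [hxu _ rfl, hB _ hp, resDist_cellMap, hw] at h1
  have h2 : (1 / 2 : ℝ) ^ m * resDist z (Q j) ≤ 4 * δ := by
    have := mul_le_mul_of_nonneg_left (resDist_le_two z (Q j))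
      (by positivity : (0 : ℝ) ≤ (1 / 2) ^ m)
    rw [pow_succ] at hm1
    linarith
  nlinarith [mul_le_mul_of_nonneg_right h2 hu.nonneg]

/-! ### Bump functions -/

/-- The function `φ` is `1` at `p` and vanishes at distance `≥ ρ` from `p`. -/
structure IsBump (φ : K → ℝ) (p : K) (ρ : ℝ) : Prop where
  eq_one : φ p = 1
  eq_zero : ∀ z, ρ ≤ resDist z p → φ z = 0

/-- A function on one cell that vanishes at the junctions extends by zero. -/
theorem exists_extend_zero (i : Fin 4) {v : C(K, ℝ)} {e : ℝ} (hv : EnergyLE v e) (h1 : v q₁ = 0)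
    (h2 : i = 0 → v q₂ = 0) (h3 : i = 1 → v q₃ = 0) :
    ∃ u : C(K, ℝ), (∀ z, u (F i z) = v z) ∧ (∀ j ≠ i, ∀ z, u (F j z) = 0) ∧
      EnergyLE u (2 * e) := by
  let g : Fin 4 → C(K, ℝ) := fun j => if j = i then v else 0
  have hg : Compatible g := by
    constructor <;> fin_cases i <;> simp [g, h1] <;> first | exact h2 rfl | exact h3 rfl
  have hge : ∀ j, EnergyLE (g j) (if j = i then e else 0) := fun j => by
    by_cases h : j = i
    · simpa only [g, if_pos h] using hv
    · simp only [g, if_neg h]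
      exact EnergyLE.const 0
  obtain ⟨u, hu, hue⟩ := exists_glue_energyLE hg hge
  refine ⟨u, fun z => by simp [hu, g], fun j hj z => by simp [hu, g, hj], hue.mono (le_of_eq ?_)⟩
  rw [← Fin.sum_univ_four (fun j => if j = i then e else 0)]
  simp

theorem IsBump.extend {i : Fin 4} {φ : C(K, ℝ)} {p : K} {ρ e : ℝ} (h : IsBump φ p ρ)
    (hv : EnergyLE φ e) (h1 : φ q₁ = 0) (h2 : i = 0 → φ q₂ = 0) (h3 : i = 1 → φ q₃ = 0) :
    ∃ u : C(K, ℝ), IsBump u (F i p) (ρ / 2) ∧ EnergyLE u (2 * e) := by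
  obtain ⟨u, hu, hu0, hue⟩ := exists_extend_zero i hv h1 h2 h3
  refine ⟨u, ⟨by rw [hu, h.eq_one], fun z hz => ?_⟩, hue⟩
  obtain ⟨j, z, rfl⟩ := exists_F_eq z
  by_cases hj : j = i
  · subst hj
    rw [hu]
    rw [resDist_F] at hz
    exact h.eq_zero _ (by linarith)
  · exact hu0 j hj z

theorem exists_bump_q₁ (k : ℕ) :
    ∃ φ : C(K, ℝ), IsBump φ q₁ ((1 / 2) ^ k) ∧ EnergyLE φ (4 * 4 ^ k) := by
  -- it suffices to glue equal functions on the two cells at `q₁`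
  have key : ∀ (v₀ v₁ : C(K, ℝ)) (ρ e : ℝ), 0 < ρ → EnergyLE v₀ e → EnergyLE v₁ e →
      v₀ q₁ = 1 → v₁ q₁ = 1 → v₀ q₂ = 0 → v₁ q₃ = 0 →
      (∀ z, 2 * ρ ≤ resDist z q₁ → v₀ z = 0 ∧ v₁ z = 0) →
      ∃ φ : C(K, ℝ), IsBump φ q₁ ρ ∧ EnergyLE φ (4 * e) := by
    intro v₀ v₁ ρ e hρ hv₀ hv₁ e1 e2 e3 e4 hz
    obtain ⟨u, hu, hue⟩ := exists_glue_energyLE (v := ![v₀, v₁, 0, 0]) (e := ![e, e, 0, 0])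
      ⟨by simp [e1, e2], by simp [e3], by simp [e4]⟩ (fun i => by
        fin_cases i
        exacts [hv₀, hv₁, EnergyLE.const 0, EnergyLE.const 0])
    refine ⟨u, ⟨?_, fun z h => ?_⟩, hue.mono (le_of_eq ?_)⟩
    · have := hu 0 q₁
      rw [F_zero_q₁] at this
      exact this.trans e1
    · obtain ⟨i, z, rfl⟩ := exists_F_eq z
      rw [hu]
      fin_cases i
      · exact (hz z (by have := resDist_F_zero_q₁ z; simp only [Fin.zero_eta] at h; linarith)).1
      · exact (hz z (by have := resDist_F_one_q₁ z; simp only [Fin.mk_one] at h; linarith)).2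
      · rfl
      · rfl
    · simp only [Matrix.cons_val]
      ring
  induction k with
  | zero =>
    obtain ⟨f, f1, f2, f3, hf⟩ := exists_harmonic_left
    obtain ⟨g, g1, g2, g3, hg⟩ := exists_harmonic_right
    let v₀ : C(K, ℝ) := ⟨fun z => -1 * f z + 1, by fun_prop⟩
    let v₁ : C(K, ℝ) := ⟨fun z => -1 * g z + 1, by fun_prop⟩
    have h0 : EnergyLE v₀ ((-1) ^ 2 * 1) := hf.affine (-1) 1
    have h1 : EnergyLE v₁ ((-1) ^ 2 * 1) := hg.affine (-1) 1
    norm_num at h0 h1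
    rw [pow_zero, pow_zero]
    exact key v₀ v₁ 1 1 one_pos h0 h1 (by simp [v₀, f1]) (by simp [v₁, g1]) (by simp [v₀, f2])
      (by simp [v₁, g3]) fun z hz => by linarith [resDist_q₁_le z]
  | succ k ih =>
    obtain ⟨v, hv, he⟩ := ih
    have hle : (1 / 2 : ℝ) ^ k ≤ 1 := pow_le_one₀ (by norm_num) (by norm_num)
    obtain ⟨φ, h1, h2⟩ := key v v ((1 / 2) ^ (k + 1)) _ (by positivity) he he hv.eq_one hv.eq_one
      (hv.eq_zero _ (by rwa [resDist_q₂_q₁])) (hv.eq_zero _ (by rwa [resDist_q₃_q₁]))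
      fun z hz => by
        have := hv.eq_zero z (by rw [pow_succ] at hz; linarith)
        exact ⟨this, this⟩
    exact ⟨φ, h1, h2.mono (le_of_eq (by ring))⟩

theorem exists_bump_q₂ (k : ℕ) :
    ∃ φ : C(K, ℝ), IsBump φ q₂ ((1 / 2) ^ k) ∧ EnergyLE φ (4 * 2 ^ k) := by
  induction k with
  | zero =>
    obtain ⟨f, f1, f2, f3, hf⟩ := exists_harmonic_left
    obtain ⟨g, hg, hg0, hge⟩ := exists_extend_zero 2 hf f1 (by simp) (by simp)
    have g1 : g q₁ = 0 := by simpa using hg0 0 (by decide) q₁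
    obtain ⟨h, hh, hh0, hhe⟩ := exists_extend_zero 2 hge g1 (by simp) (by simp)
    refine ⟨h, ⟨?_, fun z hz => ?_⟩, hhe.mono (by norm_num)⟩
    · rw [← F_two_q₂, hh, ← F_two_q₂, hg, f2]
    · rw [pow_zero] at hz
      obtain ⟨i, z, rfl⟩ := exists_F_eq z
      by_cases hi : i = 2
      · subst hi
        rw [hh]
        obtain ⟨j, z, rfl⟩ := exists_F_eq z
        by_cases hj : j = 2
        · subst hj
          rw [resDist_F_two_q₂, resDist_F_two_q₂] at hz
          linarith [resDist_le_two z q₂]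
        · exact hg0 j hj z
      · exact hh0 i hi z
  | succ k ih =>
    obtain ⟨v, hv, he⟩ := ih
    have hle : (1 / 2 : ℝ) ^ k ≤ 1 := pow_le_one₀ (by norm_num) (by norm_num)
    obtain ⟨φ, h1, h2⟩ := hv.extend (i := 2) he
      (hv.eq_zero _ (by rwa [resDist_comm, resDist_q₂_q₁])) (by simp) (by simp)
    rw [F_two_q₂] at h1
    refine ⟨φ, ⟨h1.eq_one, fun z hz => h1.eq_zero z ?_⟩, h2.mono (le_of_eq (by ring))⟩
    rw [pow_succ] at hz
    linarith

theorem exists_bump_q₃ : ∃ φ : C(K, ℝ), IsBump φ q₃ 1 ∧ EnergyLE φ 4 := by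
  obtain ⟨f, f1, f2, f3, hf⟩ := exists_harmonic_right
  obtain ⟨g, hg, hg0, hge⟩ := exists_extend_zero 3 hf f1 (by simp) (by simp)
  have g1 : g q₁ = 0 := by simpa using hg0 0 (by decide) q₁
  obtain ⟨h, hh, hh0, hhe⟩ := exists_extend_zero 3 hge g1 (by simp) (by simp)
  refine ⟨h, ⟨?_, fun z hz => ?_⟩, hhe.mono (by norm_num)⟩
  · rw [← F_three_q₃, hh, ← F_three_q₃, hg, f3]
  · obtain ⟨i, z, rfl⟩ := exists_F_eq z
    by_cases hi : i = 3
    · subst hi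
      rw [hh]
      obtain ⟨j, z, rfl⟩ := exists_F_eq z
      by_cases hj : j = 3
      · subst hj
        rw [resDist_F_three_q₃, resDist_F_three_q₃] at hz
        linarith [resDist_le_two z q₃]
      · exact hg0 j hj z
    · exact hh0 i hi z

theorem exists_bump_corner (j : Fin 3) : ∃ φ : C(K, ℝ), IsBump φ (Q j) 1 ∧ EnergyLE φ 4 := by
  fin_cases j
  · simpa using exists_bump_q₁ 0
  · simpa using exists_bump_q₂ 0
  · exact exists_bump_q₃

theorem IsBump.glue_left {f g : C(K, ℝ)} {ρ a b : ℝ} (hf : IsBump f q₂ ρ) (hg : IsBump g q₁ ρ)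
    (hfe : EnergyLE f a) (hge : EnergyLE g b) (hρ : ρ ≤ 1) :
    ∃ φ : C(K, ℝ), IsBump φ q₀ (ρ / 2) ∧ EnergyLE φ (2 * (a + b)) := by
  have f1 : f q₁ = 0 := hf.eq_zero _ (by rwa [resDist_comm, resDist_q₂_q₁])
  obtain ⟨u, hu, hue⟩ := exists_glue_energyLE (v := ![f, 0, g, 0]) (e := ![a, 0, b, 0])
    ⟨by simp [f1], by simp [hf.eq_one, hg.eq_one], by simp⟩ (fun i => by
      fin_cases i
      exacts [hfe, EnergyLE.const 0, hge, EnergyLE.const 0])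
  refine ⟨u, ⟨(hu 0 q₂).trans hf.eq_one, fun z h => ?_⟩, hue.mono (le_of_eq ?_)⟩
  · obtain ⟨i, z, rfl⟩ := exists_F_eq z
    rw [hu]
    fin_cases i
    · exact hf.eq_zero z (by have := resDist_F_zero_q₀ z; simp only [Fin.zero_eta] at h; linarith)
    · rfl
    · exact hg.eq_zero z (by have := resDist_F_two_q₀ z; simp only [Fin.reduceFinMk] at h; linarith)
    · rfl
  · simp only [Matrix.cons_val]
    ring

theorem IsBump.glue_right {f g : C(K, ℝ)} {ρ a b : ℝ} (hf : IsBump f q₃ ρ) (hg : IsBump g q₁ ρ)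
    (hfe : EnergyLE f a) (hge : EnergyLE g b) (hρ : ρ ≤ 1) :
    ∃ φ : C(K, ℝ), IsBump φ (F 3 q₁) (ρ / 2) ∧ EnergyLE φ (2 * (a + b)) := by
  have f1 : f q₁ = 0 := hf.eq_zero _ (by rwa [resDist_comm, resDist_q₃_q₁])
  obtain ⟨u, hu, hue⟩ := exists_glue_energyLE (v := ![0, f, 0, g]) (e := ![0, a, 0, b])
    ⟨by simp [f1], by simp, by simp [hf.eq_one, hg.eq_one]⟩ (fun i => by
      fin_cases i
      exacts [EnergyLE.const 0, hfe, EnergyLE.const 0, hge])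
  refine ⟨u, ⟨(hu 3 q₁).trans hg.eq_one, fun z h => ?_⟩, hue.mono (le_of_eq ?_)⟩
  · obtain ⟨i, z, rfl⟩ := exists_F_eq z
    rw [hu]
    fin_cases i
    · rfl
    · refine hf.eq_zero z ?_
      have := resDist_F 1 z q₃
      rw [F_glue_right] at this
      simp only [Fin.mk_one] at h
      linarith
    · rfl
    · refine hg.eq_zero z ?_
      have := resDist_F 3 z q₁
      simp only [Fin.reduceFinMk] at h
      linarith
  · simp only [Matrix.cons_val]
    ring

theorem exists_bump_q₀ {n : ℕ} (hn : 1 ≤ n) :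
    ∃ φ : C(K, ℝ), IsBump φ q₀ ((1 / 2) ^ n) ∧ EnergyLE φ (4 * 4 ^ n) := by
  obtain ⟨k, rfl⟩ := Nat.exists_eq_add_of_le' hn
  obtain ⟨f, hf, hfe⟩ := exists_bump_q₂ k
  obtain ⟨g, hg, hge⟩ := exists_bump_q₁ k
  obtain ⟨φ, hφ, he⟩ := hf.glue_left hg hfe hge (pow_le_one₀ (by norm_num) (by norm_num))
  refine ⟨φ, by rwa [pow_succ, mul_one_div], he.mono ?_⟩
  have : (2 : ℝ) ^ k ≤ 4 ^ k := pow_le_pow_left₀ (by norm_num) (by norm_num) k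
  rw [pow_succ]
  linarith

/-- Every vertex of level `1` is a vertex of level `l ≤ 1` with a bump of radius `2 ^ (-l)`. -/
theorem exists_bump_F_Q (i : Fin 4) (b : Fin 3) : ∃ (w : List (Fin 4)) (j : Fin 3),
    w.length ≤ 1 ∧ cellMap w (Q j) = F i (Q b) ∧
      ∃ φ : C(K, ℝ), IsBump φ (F i (Q b)) ((1 / 2) ^ w.length) ∧ EnergyLE φ (8 * 2 ^ w.length) := by
  have corner : ∀ j, F i (Q b) = Q j → ∃ (w : List (Fin 4)) (j : Fin 3),
      w.length ≤ 1 ∧ cellMap w (Q j) = F i (Q b) ∧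
      ∃ φ : C(K, ℝ), IsBump φ (F i (Q b)) ((1 / 2) ^ w.length) ∧
        EnergyLE φ (8 * 2 ^ w.length) := fun j h => by
    obtain ⟨φ, hφ, he⟩ := exists_bump_corner j
    refine ⟨[], j, by simp, h.symm, φ, ?_, he.mono (by norm_num)⟩
    rw [h]
    simpa using hφ
  have inner : ∀ p (φ : C(K, ℝ)), p = F i (Q b) → IsBump φ p (1 / 2) → EnergyLE φ 16 →
      ∃ (w : List (Fin 4)) (j : Fin 3), w.length ≤ 1 ∧ cellMap w (Q j) = F i (Q b) ∧
      ∃ φ : C(K, ℝ), IsBump φ (F i (Q b)) ((1 / 2) ^ w.length) ∧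
        EnergyLE φ (8 * 2 ^ w.length) := fun p φ hp hφ he =>
    ⟨[i], b, by simp, rfl, φ, by simpa [hp] using hφ, he.mono (by norm_num)⟩
  obtain ⟨f₁, hf₁, he₁⟩ := exists_bump_corner 0
  obtain ⟨f₂, hf₂, he₂⟩ := exists_bump_corner 1
  obtain ⟨f₃, hf₃, he₃⟩ := exists_bump_corner 2
  obtain ⟨l, hl, hle⟩ := IsBump.glue_left hf₂ hf₁ he₂ he₁ le_rfl
  obtain ⟨r, hr, hre⟩ := IsBump.glue_right hf₃ hf₁ he₃ he₁ le_rfl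
  have h21 : f₂ q₁ = 0 := hf₂.eq_zero _ (by simp [resDist_comm q₁ q₂, resDist_q₂_q₁])
  have h23 : f₂ q₃ = 0 := hf₂.eq_zero _ (by simp [resDist_q₃_q₂])
  have h31 : f₃ q₁ = 0 := hf₃.eq_zero _ (by simp [resDist_comm q₁ q₃, resDist_q₃_q₁])
  have h32 : f₃ q₂ = 0 := hf₃.eq_zero _ (by simp [resDist_comm q₂ q₃, resDist_q₃_q₂])
  have leaf₂ : (i = 1 ∨ i = 3) → ∃ φ : C(K, ℝ), IsBump φ (F i (Q 1)) (1 / 2) ∧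
      EnergyLE φ (2 * 4) := fun hi =>
    hf₂.extend he₂ h21 (by rcases hi with rfl | rfl <;> simp) fun _ => h23
  have leaf₃ : (i = 0 ∨ i = 2) → ∃ φ : C(K, ℝ), IsBump φ (F i (Q 2)) (1 / 2) ∧
      EnergyLE φ (2 * 4) := fun hi =>
    hf₃.extend he₃ h31 (fun _ => h32) (by rcases hi with rfl | rfl <;> simp)
  have hl' := hle.mono (by norm_num : (2 * (4 + 4) : ℝ) ≤ 16)
  have hr' := hre.mono (by norm_num : (2 * (4 + 4) : ℝ) ≤ 16)
  fin_cases i <;> fin_cases b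
  · exact corner 0 F_zero_q₁
  · exact inner _ l rfl hl hl'
  · obtain ⟨φ, h1, h2⟩ := leaf₃ (by simp)
    exact inner _ φ rfl h1 (h2.mono (by norm_num))
  · exact corner 0 F_one_q₁
  · obtain ⟨φ, h1, h2⟩ := leaf₂ (by simp)
    exact inner _ φ rfl h1 (h2.mono (by norm_num))
  · exact inner _ r F_glue_right.symm hr hr'
  · exact inner _ l q₀_eq hl hl'
  · exact corner 1 F_two_q₂
  · obtain ⟨φ, h1, h2⟩ := leaf₃ (by simp)
    exact inner _ φ rfl h1 (h2.mono (by norm_num))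
  · exact inner _ r rfl hr hr'
  · obtain ⟨φ, h1, h2⟩ := leaf₂ (by simp)
    exact inner _ φ rfl h1 (h2.mono (by norm_num))
  · exact corner 2 F_three_q₃

/-- Every vertex has a bump function whose radius and inverse energy are comparable to `2 ^ (-l)`,
where `l` is the first level at which the vertex occurs, although a large number of cells of
higher level may meet at the vertex. -/
theorem exists_bump_vertex (w : List (Fin 4)) (j : Fin 3) : ∃ (w' : List (Fin 4)) (j' : Fin 3),
    w'.length ≤ w.length ∧ cellMap w' (Q j') = cellMap w (Q j) ∧
      ∃ φ : C(K, ℝ), IsBump φ (cellMap w (Q j)) ((1 / 2) ^ w'.length) ∧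
        EnergyLE φ (8 * 2 ^ w'.length) := by
  induction w with
  | nil =>
    obtain ⟨φ, hφ, he⟩ := exists_bump_corner j
    exact ⟨[], j, le_rfl, rfl, φ, by simpa [cellMap] using hφ, he.mono (by norm_num)⟩
  | cons i w ih =>
    by_cases hb : ∃ b, cellMap w (Q j) = Q b
    · obtain ⟨b, hb⟩ := hb
      obtain ⟨w', j', hl, he, h⟩ := exists_bump_F_Q i b
      rw [cellMap, hb]
      exact ⟨w', j', hl.trans (by simp), he, h⟩
    · push Not at hb
      obtain ⟨w', j', hl, he, φ, hφ, hφe⟩ := ih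
      have h0 : ∀ b, φ (Q b) = 0 := fun b => by
        refine hφ.eq_zero _ ?_
        obtain ⟨k, hk⟩ := exists_resDist_vertex_Q w' j' b
        rw [resDist_comm, ← he, hk]
        have hk1 : 1 ≤ k := Nat.one_le_iff_ne_zero.2 fun h => hb b (by
          rw [← he]
          exact vertex_eq_of_resDist_eq_zero (by rw [hk, h]; simp))
        have : (1 : ℝ) ≤ k := by exact_mod_cast hk1
        exact le_mul_of_one_le_left (by positivity) this
      obtain ⟨u, hu, hue⟩ := hφ.extend (i := i) hφe (h0 0) (fun _ => h0 1) (fun _ => h0 2)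
      refine ⟨i :: w', j', by simpa using hl, by rw [cellMap, cellMap, he], u, ?_, hue.mono ?_⟩
      · rwa [List.length_cons, pow_succ, mul_one_div]
      · rw [List.length_cons, pow_succ]
        exact le_of_eq (by ring)

/-- A function that is `1` at the corners of a cell may be replaced by `1` on that cell. -/
theorem exists_fill (w : List (Fin 4)) {θ : C(K, ℝ)} (h : ∀ j, θ (cellMap w (Q j)) = 1) :
    ∃ u : C(K, ℝ), (∀ n, discreteEnergy n u ≤ discreteEnergy n θ) ∧ (∀ j, u (Q j) = θ (Q j)) ∧
      (∀ z, u (cellMap w z) = 1) ∧ ∀ x, u x = θ x ∨ ∃ z, cellMap w z = x := by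
  induction w generalizing θ with
  | nil =>
    refine ⟨1, fun n => ?_, fun j => (h j).symm, fun _ => rfl, fun x => Or.inr ⟨x, rfl⟩⟩
    exact (discreteEnergy_const n 1).le.trans (discreteEnergy_nonneg n θ)
  | cons i w ih =>
    obtain ⟨v, hve, hvQ, hv1, hv⟩ := ih (θ := θ.comp (FC i)) h
    let g : Fin 4 → C(K, ℝ) := fun k => if k = i then v else θ.comp (FC k)
    have hgQ : ∀ k j, g k (Q j) = θ (F k (Q j)) := fun k j => by
      by_cases hk : k = i
      · subst hk
        simp only [g, if_true]
        exact hvQ j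
      · simp only [g, if_neg hk]
        rfl
    have hg : Compatible g :=
      ⟨by simpa using (hgQ 0 0).trans (by simpa using (hgQ 1 0).symm),
        by simpa [F_glue_left] using (hgQ 0 1).trans (by simpa [F_glue_left] using (hgQ 2 0).symm),
        by simpa [F_glue_right] using
          (hgQ 1 2).trans (by simpa [F_glue_right] using (hgQ 3 0).symm)⟩
    obtain ⟨u, hu⟩ := exists_glue hg
    have huQ : ∀ j, u (Q j) = θ (Q j) := fun j => by
      fin_cases j
      · simpa using (hu 0 q₁).trans (hgQ 0 0)
      · simpa using (hu 2 q₂).trans (hgQ 2 1)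
      · simpa using (hu 3 q₃).trans (hgQ 3 2)
    refine ⟨u, fun n => ?_, huQ, fun z => ?_, fun x => ?_⟩
    · cases n with
      | zero =>
        have h0 : u q₁ = θ q₁ := huQ 0
        have h1 : u q₂ = θ q₂ := huQ 1
        have h2 : u q₃ = θ q₃ := huQ 2
        rw [discreteEnergy, discreteEnergy, h0, h1, h2]
      | succ n =>
        rw [discreteEnergy_succ_sum, discreteEnergy_succ_sum]
        refine mul_le_mul_of_nonneg_left (Finset.sum_le_sum fun k _ => ?_) zero_le_two
        have e : u ∘ F k = g k := funext fun z => hu k z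
        rw [e]
        by_cases hk : k = i
        · subst hk
          simp only [g, if_true]
          exact hve n
        · simp only [g, if_neg hk]
          exact le_rfl
    · rw [cellMap, hu]
      simpa [g] using hv1 z
    · obtain ⟨k, z, rfl⟩ := exists_F_eq x
      rw [hu]
      by_cases hk : k = i
      · subst hk
        simp only [g, if_true]
        rcases hv z with h | ⟨y, rfl⟩
        · exact Or.inl h
        · exact Or.inr ⟨y, rfl⟩
      · simp only [g, if_neg hk]
        exact Or.inl rfl

/-! ### Lower bounds -/

theorem IsBump.eq_zero_of_mem_compl_ball {φ : K → ℝ} {w : List (Fin 4)} {j : Fin 3} {n : ℕ}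
    (hn : 1 ≤ n) (hφ : IsBump φ (cellMap w (Q j)) ((1 / 2) ^ w.length))
    (h0 : 0 < resDist (cellMap w (Q j)) q₀) (hp : cellMap w (Q j) ∈ ball n) :
    ∀ z ∈ (ball n)ᶜ, φ z = 0 := by
  intro z hz
  rw [mem_compl_ball_iff] at hz
  rw [mem_ball_iff] at hp
  have hw : w ≠ [] := by
    rintro rfl
    have h1 := half_le_resDist_Q_q₀ j
    have h2 : (1 / 2 : ℝ) ^ n ≤ (1 / 2) ^ 1 :=
      pow_le_pow_of_le_one (by norm_num) (by norm_num) hn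
    rw [cellMap] at hp
    linarith
  obtain ⟨k, hk⟩ := exists_resDist_vertex_q₀ hw j
  have hk1 : 1 ≤ k := Nat.one_le_iff_ne_zero.2 fun h => by
    rw [hk, h] at h0
    simp at h0
  have hk1' : (1 : ℝ) ≤ k := by exact_mod_cast hk1
  have hl : (1 / 2 : ℝ) ^ w.length ≤ resDist (cellMap w (Q j)) q₀ := by
    rw [hk]
    exact le_mul_of_one_le_left (by positivity) hk1'
  have hnl : n ≤ w.length := by
    by_contra! h
    have : (1 / 2 : ℝ) ^ n ≤ (1 / 2) ^ w.length :=
      pow_le_pow_of_le_one (by norm_num) (by norm_num) h.le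
    linarith
  rw [hk] at hp
  have hgap := dyadic_gap hnl hp
  refine hφ.eq_zero z ?_
  have := resDist_triangle z (cellMap w (Q j)) q₀
  rw [hk] at this
  linarith

theorem EnergyLE.le_resistance {A : Set K} {x : K} {u : C(K, ℝ)} {e : ℝ} (hu : EnergyLE u e)
    (he : 0 < e) (hx : u x ≠ 0) (hA : ∀ z ∈ A, u z = 0) :
    ENNReal.ofReal (u x ^ 2 / e) ≤ resistance {x} A := by
  let v : C(K, ℝ) := ⟨fun z => -(u x)⁻¹ * u z + 1, by fun_prop⟩
  have hv : EnergyLE v ((-(u x)⁻¹) ^ 2 * e) := hu.affine _ _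
  have e1 : u x ^ 2 / e = ((-(u x)⁻¹) ^ 2 * e)⁻¹ := by
    field_simp
  rw [e1]
  have h2 : 0 < (-(u x)⁻¹) ^ 2 := by
    rw [neg_sq]
    positivity
  refine TreeFractal.le_resistance (mul_pos h2 he) ?_ ?_ hv
  · rintro _ rfl
    simp [v, hx]
  · intro z hz
    simp [v, hA z hz]

theorem le_resistance_of_pos {n : ℕ} (hn : 1 ≤ n) {x : K} (hx : x ∈ ball n)
    (h0 : 0 < resDist x q₀) :
    ENNReal.ofReal (min (resDist x q₀) ((1 / 2) ^ n - resDist x q₀) / 96) ≤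
      resistance {x} (ball n)ᶜ := by
  have hr := mem_ball_iff.1 hx
  set μ := min (resDist x q₀) ((1 / 2) ^ n - resDist x q₀) with hμ
  have hμ0 : 0 < μ := lt_min h0 (by linarith)
  have hμ1 : μ ≤ resDist x q₀ := min_le_left _ _
  have hμ2 : μ ≤ (1 / 2) ^ n - resDist x q₀ := min_le_right _ _
  have hn1 : (1 / 2 : ℝ) ^ n ≤ 1 := pow_le_one₀ (by norm_num) (by norm_num)
  -- a cell containing `x` of diameter less than `μ`: its corners lie in `B_n \ {q₀}`
  obtain ⟨m, hm1, hm2⟩ := exists_nat_pow_near_of_lt_one (x := μ / 2) (y := 1 / 2) (by linarith)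
    (by linarith) (by norm_num) (by norm_num)
  obtain ⟨w, z, hw, rfl⟩ := exists_cellMap_eq (m + 1) x
  have hd : ∀ y, resDist (cellMap w z) (cellMap w y) < μ := fun y => by
    rw [resDist_cellMap, hw]
    have := mul_le_mul_of_nonneg_left (resDist_le_two z y)
      (by positivity : (0 : ℝ) ≤ (1 / 2) ^ (m + 1))
    linarith
  have hpos : ∀ y, 0 < resDist (cellMap w y) q₀ := fun y => by
    linarith [hd y, resDist_triangle (cellMap w z) (cellMap w y) q₀]
  have hball : ∀ y, cellMap w y ∈ ball n := fun y => by
    rw [mem_ball_iff]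
    linarith [hd y, resDist_triangle (cellMap w y) (cellMap w z) q₀,
      resDist_comm (cellMap w y) (cellMap w z)]
  have hbump : ∀ j, ∃ φ : C(K, ℝ), φ (cellMap w (Q j)) = 1 ∧ (∀ y ∈ (ball n)ᶜ, φ y = 0) ∧
      EnergyLE φ (8 * 2 ^ (m + 1)) := fun j => by
    obtain ⟨w', j', hl, he, φ, hφ, hφe⟩ := exists_bump_vertex w j
    refine ⟨φ, hφ.eq_one, ?_, hφe.mono ?_⟩
    · rw [← he] at hφ
      exact hφ.eq_zero_of_mem_compl_ball hn (he ▸ hpos (Q j)) (he ▸ hball (Q j))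
    · rw [hw] at hl
      exact mul_le_mul_of_nonneg_left (pow_le_pow_right₀ one_le_two hl) (by norm_num)
  choose φ hφ1 hφ0 hφe using hbump
  let θ : C(K, ℝ) := ⟨fun y => min (max (max (φ 0 y) (φ 1 y)) (φ 2 y)) 1, by fun_prop⟩
  have hθe : EnergyLE θ _ := (((hφe 0).sup (hφe 1)).sup (hφe 2)).min_const 1
  have hθ1 : ∀ j, θ (cellMap w (Q j)) = 1 := fun j => by
    refine min_eq_right ?_
    fin_cases j
    · exact (hφ1 0).ge.trans ((le_max_left _ _).trans (le_max_left _ _))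
    · exact (hφ1 1).ge.trans ((le_max_right _ _).trans (le_max_left _ _))
    · exact (hφ1 2).ge.trans (le_max_right _ _)
  obtain ⟨u, hue, -, hu1, hu⟩ := exists_fill w hθ1
  have hu0 : ∀ y ∈ (ball n)ᶜ, u y = 0 := fun y hy => by
    rcases hu y with h | ⟨y, rfl⟩
    · rw [h]
      simp [θ, hφ0 _ y hy]
    · exact absurd (hball y) hy
  have huE : EnergyLE u (96 / μ) := fun k => by
    refine ((hue k).trans (hθe k)).trans ?_
    have h2 : (2 : ℝ) ^ m * (1 / 2) ^ m = 1 := by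
      rw [← mul_pow]
      norm_num
    have h3 : (2 : ℝ) ^ m * (μ / 2) ≤ 1 := by
      rw [← h2]
      exact mul_le_mul_of_nonneg_left hm2 (by positivity)
    rw [le_div_iff₀ hμ0, pow_succ]
    linarith
  have := huE.le_resistance (A := (ball n)ᶜ) (x := cellMap w z) (by positivity)
    (by rw [hu1]; exact one_ne_zero) hu0
  rwa [hu1, one_pow, one_div_div] at this

/-- Close to `q₀` the bump function of `q₀` is at least `1/2`, as it is Hölder continuous. -/
theorem le_resistance_of_lt {n : ℕ} (hn : 1 ≤ n) {x : K}
    (hx : resDist x q₀ < (1 / 2) ^ (2 * n) / 16) :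
    ENNReal.ofReal ((1 / 2) ^ (2 * n) / 16) ≤ resistance {x} (ball n)ᶜ := by
  obtain ⟨φ, hφ, he⟩ := exists_bump_q₀ hn
  have h4 : (1 / 2 : ℝ) ^ (2 * n) * 4 ^ n = 1 := by
    rw [pow_mul, ← mul_pow]
    norm_num
  have h1 := he.sq_sub_le x q₀
  have h2 : resDist x q₀ * (4 * 4 ^ n) ≤ 1 / 4 := by
    have := mul_le_mul_of_nonneg_right hx.le (by positivity : (0 : ℝ) ≤ 4 * 4 ^ n)
    linarith
  rw [hφ.eq_one] at h1
  have h3 : 1 / 2 ≤ φ x := by nlinarith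
  refine le_trans (ENNReal.ofReal_le_ofReal ?_)
    (he.le_resistance (A := (ball n)ᶜ) (x := x) (by positivity) (by linarith) fun z hz =>
      hφ.eq_zero z (mem_compl_ball_iff.1 hz))
  rw [le_div_iff₀ (by positivity)]
  nlinarith

end TreeFractal

/-- The resistance from a point `x` of `B_n` to the complement of `B_n` is comparable to
`(2^{-n} - R(x, q₀)) ∧ (R(x, q₀) + 2^{-2n})`, uniformly in `n ≥ 1` and `x`. -/
theorem mainTheorem4 :
    ∃ C : ℝ, 1 ≤ C ∧ ∀ n : ℕ, 1 ≤ n → ∀ x ∈ TreeFractal.ball n,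
      ENNReal.ofReal (C⁻¹ * min ((1 / 2) ^ n - (TreeFractal.R x TreeFractal.q₀).toReal)
          ((TreeFractal.R x TreeFractal.q₀).toReal + (1 / 2) ^ (2 * n))) ≤
        TreeFractal.resistance {x} (TreeFractal.ball n)ᶜ ∧
      TreeFractal.resistance {x} (TreeFractal.ball n)ᶜ ≤
        ENNReal.ofReal (C * min ((1 / 2) ^ n - (TreeFractal.R x TreeFractal.q₀).toReal)
          ((TreeFractal.R x TreeFractal.q₀).toReal + (1 / 2) ^ (2 * n))) := by
  refine ⟨2000, by norm_num, fun n hn x hx => ?_⟩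
  have hr := TreeFractal.mem_ball_iff.1 hx
  have hr0 := TreeFractal.resDist_nonneg x TreeFractal.q₀
  have hadd := TreeFractal.resistance_le_add hn x
  have hsub := TreeFractal.resistance_le_sub hn hx
  have hpos := TreeFractal.le_resistance_of_pos hn hx
  have hlt := TreeFractal.le_resistance_of_lt hn (x := x)
  change _ ∧ _ ≤ ENNReal.ofReal (2000 * min ((1 / 2) ^ n - TreeFractal.resDist x TreeFractal.q₀)
    (TreeFractal.resDist x TreeFractal.q₀ + (1 / 2) ^ (2 * n)))
  change ENNReal.ofReal (2000⁻¹ * min ((1 / 2) ^ n - TreeFractal.resDist x TreeFractal.q₀)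
    (TreeFractal.resDist x TreeFractal.q₀ + (1 / 2) ^ (2 * n))) ≤ _ ∧ _
  have hε : (0 : ℝ) < (1 / 2) ^ (2 * n) := by positivity
  generalize TreeFractal.resDist x TreeFractal.q₀ = r at *
  generalize (1 / 2 : ℝ) ^ (2 * n) = ε at *
  generalize (1 / 2 : ℝ) ^ n = ρ at *
  have hδ := min_le_left (ρ - r) (r + ε)
  have hs := min_le_right (ρ - r) (r + ε)
  constructor
  · rcases lt_or_ge r (ε / 16) with h | h
    · exact (ENNReal.ofReal_le_ofReal (by linarith)).trans (hlt h)
    · refine (ENNReal.ofReal_le_ofReal ?_).trans (hpos (by linarith))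
      have : 0 < min (ρ - r) (r + ε) := lt_min (by linarith) (by linarith)
      rcases min_choice r (ρ - r) with h' | h' <;> rw [h'] <;> linarith
  · rcases min_choice (ρ - r) (r + ε) with h | h <;> rw [h]
    · exact hsub.trans (ENNReal.ofReal_le_ofReal (by linarith))
    · exact hadd.trans (ENNReal.ofReal_le_ofReal (by linarith))
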